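/- **Setting.** In online two-dimensional vector packing, vectors $v_1,\dots,v_n\in[0,1]^2$ (the sequence $\sigma$) arrive one by one, and each must irrevocably be put into an open bin or a new bin on arrival. In every bin the sum $s$ of its vectors must satisfy $\|s\|_\infty\le 1$. $|\mathrm{OPT}(\sigma)|$ is the least number of bins in such a packing of $\sigma$. **Grid.** Let $k\ge 1$. A vector $v\in[0,1]^2$ lies in the $(i,j)$-box, $1\le i,j\le k$, if $v_x\in\,](i-1)/k,i/k]$ and $v_y\in\,](j-1)/k,j/k]$, where the coordinate $0$ is counted to the first interval. Its $k$-scaled vector is $(i/k,j/k)$. The vector $v$ is short if $v_x\le 40/k$ and $v_y\le 40/k$, and long otherwise. **Strategy $A_k$.** The advice consists of the $k^2$ numbers $n_{i,j}$ of long vectors of $\sigma$ in the $(i,j)$-boxes, each written with $\lceil\log_2(n+1)\rceil$ bits, concatenated to a string $s$ and encoded in a self-delimiting way as $1^{|b|}\,0\,b\,s$, where $b$ is the binary representation of $|s|$. From these numbers $A_k$ computes an optimal packing of the $k$-scaled long vectors and opens one critical bin for each bin of that packing. In a critical bin, one place is reserved for each of its $k$-scaled vectors, and its virtual load is initially the sum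 of the $L_1$-norms of these $k$-scaled vectors. The requests are then served in order: - A long vector $v$ in the $(i,j)$-box is put into the first bin with an unused place reserved for the $(i,j)$-box. It uses up this place, and the virtual load of the bin decreases by $i/k+j/k-\|v\|_1$. - A short vector $v$ is put into the first open bin whose virtual load is at most $1-\|v\|_1$, and the virtual load of that bin increases by $\|v\|_1$. If there is no such bin, $v$ is put into a new bin with virtual load $\|v\|_1$. **Theorem.** Let $k\ge 640$ be an even constant. 1. The number of advice bits that $A_k$ reads is $O(\log n)$, with a constant that depends only on $k$. 2. For some rule for choosing the optimal packing of the $k$-scaled long vectors as a function of the numbers $n_{i,j}$, the strategy $A_k$ runs in polynomial time. More precisely, there is a program for a random access machine with natural-number and real cells (unit-cost addition, subtraction and comparison, indirect addressing, rational constants) and a one-way advice tape such that, for every $\sigma\in([0,1]^2)^n$ and every tape that begins with the advice for $\sigma$, the program reads exactly this advice, puts every vector into the same bin as $A_k$, and takes at most $p(n)$ steps in total. The program and the polynomial $p$ depend only on $k$. 3. Whichever optimal packing of the $k$-scaled long vectors is used, for every $\sigma$ in $[0,1]^2$ the strategy $A_k$ produces a feasible packing of $\sigma$ and opens at most $$\tfrac52\,|\mathrm{OPT}(\sigma)|+1$$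 bins. -/

import Mathlib

noncomputable section

namespace VectorPacking

/-! ### Vectors, packings, optimal packings -/

/-- Plane vectors. The norm of the product type `ℝ × ℝ` is the maximum norm. -/
abbrev Vec : Type := ℝ × ℝ

/-- The `L₁`-norm. -/
def l1 (v : Vec) : ℝ := |v.1| + |v.2|

/-- `P` is a packing of the multiset `S` of vectors: `P` is a list of bins that partitions `S`, and
the vectors in each bin have a sum of maximum norm at most `1`. -/
def IsPacking (P : List (Multiset Vec)) (S : Multiset Vec) : Prop :=
  P.sum = S ∧ ∀ B ∈ P, ‖B.sum‖ ≤ 1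

/-- The least number of bins in a packing of `S`. -/
def opt (S : Multiset Vec) : ℕ := sInf {m | ∃ P, IsPacking P S ∧ P.length = m}

/-! ### The grid, short and long vectors, scaling -/

/-- The index pair `(i, j)`, `1 ≤ i, j ≤ k`, of a grid box. -/
abbrev Box : Type := ℕ × ℕ

/-- The `i` with `x ∈ ](i-1)/k, i/k]`, where `0` is put into the first interval. -/
def gridIndex (k : ℕ) (x : ℝ) : ℕ := max 1 ⌈(k : ℝ) * x⌉₊

/-- The box that contains `v`. -/
def boxOf (k : ℕ) (v : Vec) : Box := (gridIndex k v.1, gridIndex k v.2)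

/-- The common value of all `k`-scaled vectors from the box `b`. -/
def scaled (k : ℕ) (b : Box) : Vec := ((b.1 : ℝ) / k, (b.2 : ℝ) / k)

/-- Short vectors; all other vectors are long. -/
abbrev IsShort (k : ℕ) (v : Vec) : Prop := v.1 ≤ 40 / (k : ℝ) ∧ v.2 ≤ 40 / (k : ℝ)

/-- The boxes of the long vectors of `σ`, with multiplicity. -/
def longBoxes (k : ℕ) (σ : List Vec) : Multiset Box :=
  ((σ.filter (fun v => ¬ IsShort k v)).map (boxOf k) : List Box)

/-- `P` describes an optimal packing of the `k`-scaled vectors that belong to the boxes in `N`. -/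
def IsOptimalBoxPacking (k : ℕ) (P : List (Multiset Box)) (N : Multiset Box) : Prop :=
  P.sum = N ∧
  IsPacking (P.map (Multiset.map (scaled k))) (N.map (scaled k)) ∧
  P.length = opt (N.map (scaled k))

/-! ### The strategy -/

/-- An open bin, as the strategy sees it. -/
structure Bin where
  /-- the reserved places that have not been used yet, one for a scaled vector of each listed box -/
  slots : Multiset Box
  /-- the virtual load -/
  vload : ℝ
  /-- the vectors that have been put into the bin -/
  content : Multiset Vec

/-- The critical bin that is opened for a bin of the packing of the scaled long vectors. -/
def criticalBin (k : ℕ) (t : Multiset Box) : Bin :=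
  ⟨t, (t.map (fun b => l1 (scaled k b))).sum, 0⟩

/-- A new bin that contains just `v`. -/
def newBin (v : Vec) : Bin := ⟨0, l1 v, {v}⟩

/-- May the vector `v` go into the bin `B`?  A long vector needs an unused reserved place for its
box; a short vector needs that the virtual load does not exceed `1` with `v` included. -/
def accepts (k : ℕ) (v : Vec) (B : Bin) : Bool :=
  if IsShort k v then decide (B.vload + l1 v ≤ 1) else decide (boxOf k v ∈ B.slots)

/-- The bin `B` after `v` has been put into it. -/
def addTo (k : ℕ) (v : Vec) (B : Bin) : Bin :=
  if IsShort k v then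
    ⟨B.slots, B.vload + l1 v, v ::ₘ B.content⟩
  else
    ⟨B.slots.erase (boxOf k v), B.vload - (l1 (scaled k (boxOf k v)) - l1 v), v ::ₘ B.content⟩

/-- The index of the first open bin that accepts `v`, or of a new bin (the number of open bins) if
there is none. -/
def choice (k : ℕ) (bins : List Bin) (v : Vec) : ℕ := bins.findIdx (accepts k v)

/-- The open bins after `v` has been served. -/
def serve (k : ℕ) (bins : List Bin) (v : Vec) : List Bin :=
  if choice k bins v < bins.length then bins.modify (choice k bins v) (addTo k v)
  else bins ++ [newBin v]

/-- The critical bins, which the strategy opens before the first request. -/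
def criticalBins (k : ℕ) (P : List (Multiset Box)) : List Bin := P.map (criticalBin k)

/-- All bins that the strategy has opened when it has served `σ`; `P` is the packing of the
scaled long vectors that it uses. -/
def finalBins (k : ℕ) (P : List (Multiset Box)) (σ : List Vec) : List Bin :=
  σ.foldl (serve k) (criticalBins k P)

/-- The bins that are chosen for the successive requests, starting from the given open bins. -/
def choices (k : ℕ) : List Bin → List Vec → List ℕ
  | _, [] => []
  | bins, v :: σ => choice k bins v :: choices k (serve k bins v) σ

/-! ### The advice -/

/-- The binary representation of `m` with `w` digits, most significant digit first. -/
def binary (w m : ℕ) : List Bool := (List.range w).reverse.map (fun i => m.testBit i)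

/-- The self-delimiting encoding of a bit string `s`: the binary representation `b` of the length of
`s`, preceded by `|b|` ones and a zero, and followed by `s`.
(`Nat.size m` is the number `⌈log₂ (m + 1)⌉` of binary digits of `m`.) -/
def selfDelimiting (s : List Bool) : List Bool :=
  List.replicate (Nat.size s.length) true ++ [false] ++ binary (Nat.size s.length) s.length ++ s

/-- All boxes of the grid. -/
def allBoxes (k : ℕ) : List Box := (List.range' 1 k).product (List.range' 1 k)

/-- The advice for `σ`: the number of long vectors in each box, each number written with
`⌈log₂ (n + 1)⌉` binary digits, where `n` is the length of `σ`. -/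
def advice (k : ℕ) (σ : List Vec) : List Bool :=
  selfDelimiting
    ((allBoxes k).flatMap (fun b => binary (Nat.size σ.length) ((longBoxes k σ).count b)))

/-! ### The machine model

A random access machine with natural-number cells and real-number cells, indirect addressing,
addition, subtraction and comparison at unit cost (no multiplication, no rounding of reals), and
a one-way advice tape. Programs are written in structured form. -/

/-- A machine configuration. -/
structure Config where
  /-- natural-number memory -/
  nat : ℕ → ℕ
  /-- real-number memory -/
  real : ℕ → ℝ
  /-- the number of advice bits read so far -/
  head : ℕ

/-- Natural-number expressions; `cell a` is the content of the cell with address `a`. -/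
inductive NExp where
  | const (c : ℕ)
  | cell (a : NExp)
  | add (e f : NExp)
  | sub (e f : NExp)

/-- The value of a natural-number expression (subtraction is truncated). -/
def NExp.eval (s : Config) : NExp → ℕ
  | const c => c
  | cell a => s.nat (a.eval s)
  | add e f => e.eval s + f.eval s
  | sub e f => e.eval s - f.eval s

/-- Real-number expressions. -/
inductive RExp where
  | const (q : ℚ)
  | cell (a : NExp)
  | add (e f : RExp)
  | sub (e f : RExp)

/-- The value of a real-number expression. -/
def RExp.eval (s : Config) : RExp → ℝ
  | const q => (q : ℝ)
  | cell a => s.real (a.eval s)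
  | add e f => e.eval s + f.eval s
  | sub e f => e.eval s - f.eval s

/-- Tests. -/
inductive Test where
  | leN (e f : NExp)
  | leR (e f : RExp)
  | not (b : Test)
  | and (b c : Test)

/-- The truth value of a test. -/
def Test.Holds (s : Config) : Test → Prop
  | leN e f => e.eval s ≤ f.eval s
  | leR e f => e.eval s ≤ f.eval s
  | not b => ¬ b.Holds s
  | and b c => b.Holds s ∧ c.Holds s

/-- Programs. -/
inductive Prog where
  | skip
  | setN (a e : NExp)
  | setR (a : NExp) (e : RExp)
  | readBit (a : NExp)
  | seq (p q : Prog)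
  | ite (b : Test) (p q : Prog)
  | loop (b : Test) (p : Prog)

/-- `Exec tape p s t s'`: started in `s`, the program `p` halts in `s'` after `t` steps. Each
executed assignment, reading of a bit and test is one step (the expressions in a fixed program have
a fixed size). -/
inductive Exec (tape : ℕ → Bool) : Prog → Config → ℕ → Config → Prop
  | skip (s : Config) : Exec tape .skip s 1 s
  | setN (a e : NExp) (s : Config) :
      Exec tape (.setN a e) s 1 { s with nat := Function.update s.nat (a.eval s) (e.eval s) }
  | setR (a : NExp) (e : RExp) (s : Config) :
      Exec tape (.setR a e) s 1 { s with real := Function.update s.real (a.eval s) (e.eval s) }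
  | readBit (a : NExp) (s : Config) :
      Exec tape (.readBit a) s 1
        { s with nat := Function.update s.nat (a.eval s) (tape s.head).toNat, head := s.head + 1 }
  | seq {p q : Prog} {s s' s'' : Config} {t t' : ℕ} :
      Exec tape p s t s' → Exec tape q s' t' s'' → Exec tape (.seq p q) s (t + t') s''
  | iteTrue {b : Test} {p q : Prog} {s s' : Config} {t : ℕ} :
      b.Holds s → Exec tape p s t s' → Exec tape (.ite b p q) s (1 + t) s'
  | iteFalse {b : Test} {p q : Prog} {s s' : Config} {t : ℕ} :
      ¬ b.Holds s → Exec tape q s t s' → Exec tape (.ite b p q) s (1 + t) s'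
  | loopEnd {b : Test} {p : Prog} {s : Config} :
      ¬ b.Holds s → Exec tape (.loop b p) s 1 s
  | loopStep {b : Test} {p : Prog} {s s' s'' : Config} {t t' : ℕ} :
      b.Holds s → Exec tape p s t s' → Exec tape (.loop b p) s' t' s'' →
      Exec tape (.loop b p) s (1 + t + t') s''

/-- The configuration `s` with the request `v` written into the real cells `0` and `1`. -/
def Config.input (s : Config) (v : Vec) : Config :=
  { s with real := Function.update (Function.update s.real 0 v.1) 1 v.2 }

/-- `Serves tape p s σ out t s'`: the requests in `σ` are presented one by one, starting in `s`. For
each one, `p` is executed, and the number that it leaves in the natural-number cell `0` is the index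
of the bin in which the request is put, recorded in `out`. This takes `t` steps and ends in `s'`. -/
inductive Serves (tape : ℕ → Bool) (p : Prog) :
    Config → List Vec → List ℕ → ℕ → Config → Prop
  | nil (s : Config) : Serves tape p s [] [] 0 s
  | cons {s s' s'' : Config} {v : Vec} {σ : List Vec} {out : List ℕ} {t t' : ℕ} :
      Exec tape p (s.input v) t s' → Serves tape p s' σ out t' s'' →
      Serves tape p s (v :: σ) (s'.nat 0 :: out) (t + t') s''

/-- A program for an online problem: `setup` is executed before the first request and `step` on
every request. -/
structure OnlineProg where
  setup : Prog
  step : Prog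

/-- `M.Runs tape σ out t bits`: with the given advice tape, starting with empty memory, `M` puts the
requests in `σ` into the bins listed in `out`, takes `t` steps in total and reads `bits` bits. -/
def OnlineProg.Runs (M : OnlineProg) (tape : ℕ → Bool) (σ : List Vec) (out : List ℕ)
    (t bits : ℕ) : Prop :=
  ∃ (s s' : Config) (t₁ t₂ : ℕ),
    Exec tape M.setup ⟨fun _ => 0, fun _ => 0, 0⟩ t₁ s ∧ Serves tape M.step s σ out t₂ s' ∧
    t = t₁ + t₂ ∧ bits = s'.head

/-- The tape starts with the bit string `l` (and continues arbitrarily). -/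
def StartsWith (tape : ℕ → Bool) (l : List Bool) : Prop := ∀ i : Fin l.length, tape i = l.get i

end VectorPacking

end

noncomputable section

namespace VectorPacking

/-! ### Splitting the scaled long vectors of a bin -/

/-! Competitive ratio. Two counting arguments apply, according to whether a short vector ever forces
a new bin.

If none does, all bins are critical, and their number is the optimum for the scaled long vectors.
This optimum is bounded by repacking an optimal packing of `σ`. A long vector has L₁-norm above 40/k
and a bin has L₁-norm at most 2, so scaling raises each coordinate of the sum of its long vectors by
at most 1/20. Since k is even, 1/2 is a grid line, and at most two of the scaled vectors exceed 1/2
in some coordinate. Such a multiset splits into two full bins and one half bin (`splitsInThree`).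
Half bins are merged in pairs, which makes five bins out of two (`exists_packing_of_splitsInThree`,
`two_mul_opt_longBoxes_le`).

If a new bin is opened, every bin open at that moment has virtual load above 1 - 80/k, because a
short vector has L₁-norm at most 80/k. Each later long vector lowers a virtual load by at most 2/k.
Hence `Bin.potential`, which credits 2/k per long vector, never decreases (`potential_le_addTo`). In
the end no reserved place is left, the virtual load is the L₁-norm of the content, and the credit is
at most 1/20 of that norm. So all bins but one have content of L₁-norm at least 4/5
(`four_fifths_le_of_not_poor`), while the total is at most 2 OPT. `BinsInv` carries both cases
through the run.

Feasibility holds because in every bin the content together with the scaled vectors still expected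
stays below 1 in both coordinates (`Bin.Inv`).

Running time. For fixed k a bin of scaled vectors has one of finitely many contents (`patterns`). A
packing is then, up to order, a tuple of multiplicities, each of which can be taken to be at most n,
and trying all tuples is polynomial. `searchResult` is this search as a function; `tot_search` shows
that the program computes it. Whatever depends only on a bin type and a box is compiled into the
program as a table of constants. Programs are verified in the total-correctness calculus with time
bounds given by `Tot`. -/

theorem exists_maximal_submultiset {α : Type*} (M : Multiset α) (P : Multiset α → Prop)
    (h0 : P 0) : ∃ S T, S + T = M ∧ P S ∧ ∀ a ∈ T, ¬ P (a ::ₘ S) := by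
  classical
  obtain ⟨S, hS, hmax⟩ := Finset.exists_max_image (M.powerset.toFinset.filter P) Multiset.card
    ⟨0, by simp [h0]⟩
  simp only [Finset.mem_filter, Multiset.mem_toFinset, Multiset.mem_powerset] at hS hmax
  obtain ⟨T, rfl⟩ := Multiset.le_iff_exists_add.1 hS.1
  refine ⟨S, T, rfl, hS.2, fun a ha hP => ?_⟩
  have := hmax (a ::ₘ S) ⟨?_, hP⟩
  · simp at this
  · rw [← Multiset.singleton_add, add_comm]
    exact add_le_add_right (Multiset.singleton_le.2 ha) S

theorem sum_map_nonneg_of {α : Type*} {M : Multiset α} {φ : α → ℝ} (h : ∀ v ∈ M, 0 ≤ φ v) :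
    0 ≤ (M.map φ).sum :=
  Multiset.sum_nonneg (by simpa using h)

/-- An item of size at least 1/2 gets its own part and leaves at most 1 for the rest. If all items
are smaller than 1/2, a maximal part of size at most 1 that leaves something over is larger than
1/2, so what is left is smaller than 1. -/
theorem exists_split_of_sum_le {α : Type*} (M : Multiset α) (φ : α → ℝ) (h0 : ∀ v ∈ M, 0 ≤ φ v)
    (h1 : ∀ v ∈ M, φ v ≤ 1) (hs : (M.map φ).sum ≤ 3 / 2) :
    ∃ A B, A + B = M ∧ (A.map φ).sum ≤ 1 ∧ (B.map φ).sum ≤ 1 := by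
  by_cases hbig : ∃ v ∈ M, 1 / 2 ≤ φ v
  · obtain ⟨v, hv, hv2⟩ := hbig
    obtain ⟨M', rfl⟩ := Multiset.exists_cons_of_mem hv
    refine ⟨{v}, M', Multiset.singleton_add _ _, by simpa using h1 v hv, ?_⟩
    simp only [Multiset.map_cons, Multiset.sum_cons] at hs
    linarith
  · push Not at hbig
    obtain ⟨S, T, rfl, hS, hmax⟩ := exists_maximal_submultiset M (fun S => (S.map φ).sum ≤ 1)
      (by simp)
    refine ⟨S, T, rfl, hS, ?_⟩
    rcases T.empty_or_exists_mem with rfl | ⟨a, ha⟩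
    · simp
    · have h2 := hmax a ha
      have h3 := hbig a (by simp [ha])
      simp only [Multiset.map_cons, Multiset.sum_cons, not_le, Multiset.map_add,
        Multiset.sum_add] at h2 hs
      linarith

theorem fst_sum (M : Multiset Vec) : M.sum.1 = (M.map Prod.fst).sum :=
  map_multiset_sum (AddMonoidHom.fst ℝ ℝ) M

theorem snd_sum (M : Multiset Vec) : M.sum.2 = (M.map Prod.snd).sum :=
  map_multiset_sum (AddMonoidHom.snd ℝ ℝ) M

/-- Setting `R` aside brings one coordinate of the total of `M` down to at most 1, so that this
coordinate is harmless in every split. The other one has total at most 5/4 ≤ 3/2, and the problem is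
one-dimensional. -/
theorem exists_split_aux (M R : Multiset Vec) (h0 : ∀ v ∈ M + R, 0 ≤ v) (h1 : ∀ v ∈ M + R, v ≤ 1)
    (hs : (M + R).sum ≤ (5 / 4, 5 / 4)) (hR : 1 / 4 ≤ R.sum.1 ∨ 1 / 4 ≤ R.sum.2) :
    ∃ A B, A + B = M ∧ A.sum ≤ 1 ∧ B.sum ≤ 1 := by
  have hR0 : 0 ≤ R.sum := Multiset.sum_nonneg fun v hv => h0 v (by simp [hv])
  rw [Multiset.sum_add] at hs
  obtain ⟨hs1, hs2⟩ := Prod.le_def.1 hs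
  obtain ⟨hR1, hR2⟩ := Prod.le_def.1 hR0
  simp only [Prod.fst_add, Prod.snd_add, Prod.fst_zero, Prod.snd_zero] at hs1 hs2 hR1 hR2
  have key : ∀ A B : Multiset Vec, A + B = M → A.sum.1 + B.sum.1 = M.sum.1 ∧
      A.sum.2 + B.sum.2 = M.sum.2 ∧ 0 ≤ A.sum ∧ 0 ≤ B.sum := by
    rintro A B rfl
    refine ⟨by simp, by simp, Multiset.sum_nonneg fun v hv => h0 v (by simp [hv]),
      Multiset.sum_nonneg fun v hv => h0 v (by simp [hv])⟩
  simp only [Prod.le_def, Prod.fst_zero, Prod.snd_zero, Prod.fst_one, Prod.snd_one] at key h0 h1 ⊢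
  rcases hR with hR | hR
  · obtain ⟨A, B, hAB, hA, hB⟩ := exists_split_of_sum_le M Prod.snd
      (fun v hv => (h0 v (by simp [hv])).2) (fun v hv => (h1 v (by simp [hv])).2)
      (by rw [← snd_sum]; linarith)
    rw [← snd_sum] at hA hB
    obtain ⟨k1, k2, k3, k4⟩ := key A B hAB
    exact ⟨A, B, hAB, ⟨by linarith, hA⟩, by linarith, hB⟩
  · obtain ⟨A, B, hAB, hA, hB⟩ := exists_split_of_sum_le M Prod.fst
      (fun v hv => (h0 v (by simp [hv])).1) (fun v hv => (h1 v (by simp [hv])).1)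
      (by rw [← fst_sum]; linarith)
    rw [← fst_sum] at hA hB
    obtain ⟨k1, k2, k3, k4⟩ := key A B hAB
    exact ⟨A, B, hAB, ⟨hA, by linarith⟩, hB, by linarith⟩

/-- `M` can be packed into two bins and one half bin. -/
def SplitsInThree (M : Multiset Vec) : Prop :=
  ∃ A B R, A + B + R = M ∧ A.sum ≤ 1 ∧ B.sum ≤ 1 ∧ R.sum ≤ (1 / 2, 1 / 2)

/-- Let `S` be a maximal multiset of small vectors that fits into the half bin. If it exhausts the
small vectors, the at most two others get a bin each. Otherwise a remaining small vector `o`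
overfills `S` in some coordinate, so `S` or `o` has a coordinate of at least 1/4. That one goes into
the half bin, and `exists_split_aux` packs the rest. -/
theorem splitsInThree (M : Multiset Vec) (h0 : ∀ v ∈ M, 0 ≤ v) (h1 : ∀ v ∈ M, v ≤ 1)
    (hs : M.sum ≤ (5 / 4, 5 / 4))
    (hbig : (M.filter (fun v => ¬ v ≤ (1 / 2, 1 / 2))).card ≤ 2) : SplitsInThree M := by
  obtain ⟨S, T, hST, hS, hmax⟩ := exists_maximal_submultiset
    (M.filter (fun v => v ≤ (1 / 2, 1 / 2))) (fun S => S.sum ≤ (1 / 2, 1 / 2))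
    (by simp [Prod.le_def])
  have hM := Multiset.filter_add_not (fun v : Vec => v ≤ (1 / 2, 1 / 2)) M
  set L := M.filter (fun v => ¬ v ≤ (1 / 2, 1 / 2)) with hL
  have hsm : ∀ v ∈ S + T, v ≤ (1 / 2, 1 / 2) := by rw [hST]; simp
  rw [← hST] at hM
  rcases T.empty_or_exists_mem with rfl | ⟨o, ho⟩
  · have hLe : ∃ A B, A + B = L ∧ A.sum ≤ 1 ∧ B.sum ≤ 1 := by
      have hL1 : ∀ v ∈ L, v ≤ 1 := fun v hv => h1 v (Multiset.mem_of_mem_filter hv)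
      have h01 : (0 : Vec) ≤ 1 := zero_le_one
      have : L.card = 0 ∨ L.card = 1 ∨ L.card = 2 := by omega
      rcases this with h | h | h
      · rw [Multiset.card_eq_zero] at h
        exact ⟨0, 0, by simp [h], by simp, by simp⟩
      · obtain ⟨a, ha⟩ := Multiset.card_eq_one.1 h
        exact ⟨{a}, 0, by simp [ha], by simpa using hL1 a (by simp [ha]), by simp⟩
      · obtain ⟨a, b, ha⟩ := Multiset.card_eq_two.1 h
        exact ⟨{a}, {b}, by rw [ha]; rfl, by simpa using hL1 a (by simp [ha]),
          by simpa using hL1 b (by simp [ha])⟩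
    obtain ⟨A, B, hAB, hA, hB⟩ := hLe
    exact ⟨A, B, S, by rw [hAB, ← hM]; abel, hA, hB, hS⟩
  · have h2 := hmax o ho
    have h3 := hsm o (by simp [ho])
    obtain ⟨T', rfl⟩ := Multiset.exists_cons_of_mem ho
    have hq : (1 / 4 ≤ S.sum.1 ∨ 1 / 4 ≤ S.sum.2) ∨ (1 / 4 ≤ o.1 ∨ 1 / 4 ≤ o.2) := by
      by_contra hcon
      push Not at hcon
      apply h2
      simp only [Multiset.sum_cons, Prod.le_def, Prod.fst_add, Prod.snd_add]
      constructor <;> linarith [hcon.1.1, hcon.1.2, hcon.2.1, hcon.2.2]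
    rcases hq with hq | hq
    · have hM' : (o ::ₘ T' + L) + S = M := by rw [← hM]; abel
      rw [← hM'] at h0 h1 hs
      obtain ⟨A, B, hAB, hA, hB⟩ := exists_split_aux _ _ h0 h1 hs hq
      exact ⟨A, B, S, by rw [hAB, hM'], hA, hB, hS⟩
    · have hM' : (S + T' + L) + {o} = M := by
        rw [← hM, ← Multiset.singleton_add]; abel
      rw [← hM'] at h0 h1 hs
      obtain ⟨A, B, hAB, hA, hB⟩ := exists_split_aux _ _ h0 h1 hs (by simpa using hq)
      exact ⟨A, B, {o}, by rw [hAB, hM'], hA, hB, by simpa using h3⟩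

/-- Two half bins share one bin, so two multisets need five bins. An unpaired half bin costs a whole
bin, whence the `+ 1`. -/
theorem exists_packing_of_splitsInThree : ∀ Ms : List (Multiset Vec),
    (∀ M ∈ Ms, SplitsInThree M) → ∃ P : List (Multiset Vec), P.sum = Ms.sum ∧
      (∀ B ∈ P, B.sum ≤ 1) ∧ 2 * P.length ≤ 5 * Ms.length + 1
  | [], _ => ⟨[], by simp⟩
  | [M], h => by
    obtain ⟨A, B, R, rfl, hA, hB, hR⟩ := h M (by simp)
    refine ⟨[A, B, R], by simp [add_assoc], ?_, by simp⟩
    have : R.sum ≤ 1 := hR.trans (by rw [Prod.le_def]; norm_num)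
    simp [hA, hB, this]
  | M :: M' :: Ms, h => by
    obtain ⟨A, B, R, rfl, hA, hB, hR⟩ := h M (by simp)
    obtain ⟨A', B', R', rfl, hA', hB', hR'⟩ := h M' (by simp)
    obtain ⟨P, hP, hP1, hP2⟩ := exists_packing_of_splitsInThree Ms fun M hM => h M (by simp [hM])
    refine ⟨A :: B :: A' :: B' :: (R + R') :: P, ?_, ?_, ?_⟩
    · simp only [List.sum_cons, hP]; abel
    · have : (R + R').sum ≤ 1 := by
        rw [Multiset.sum_add]
        exact (add_le_add hR hR').trans (by rw [Prod.le_def]; norm_num)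
      simp only [List.mem_cons, forall_eq_or_imp]
      exact ⟨hA, hB, hA', hB', this, hP1⟩
    · simp only [List.length_cons] at *
      omega

/-! ### Scaling -/

theorem gridIndex_pos (k : ℕ) (x : ℝ) : 1 ≤ gridIndex k x := le_max_left _ _

theorem gridIndex_le {k m : ℕ} (hk : 0 < k) (hm : 1 ≤ m) {x : ℝ} (hx : x ≤ m / k) :
    gridIndex k x ≤ m := by
  have hk' : (0 : ℝ) < k := by exact_mod_cast hk
  refine max_le hm (Nat.ceil_le.2 ?_)
  rw [le_div_iff₀ hk'] at hx
  linarith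

theorem le_gridIndex_div {k : ℕ} (hk : 0 < k) (x : ℝ) : x ≤ (gridIndex k x : ℝ) / k := by
  have hk' : (0 : ℝ) < k := by exact_mod_cast hk
  rw [le_div_iff₀ hk', mul_comm]
  refine (Nat.le_ceil _).trans ?_
  exact_mod_cast le_max_right _ _

theorem gridIndex_div_le {k : ℕ} (hk : 0 < k) {x : ℝ} (hx : 0 ≤ x) :
    (gridIndex k x : ℝ) / k ≤ x + 1 / k := by
  have hk' : (0 : ℝ) < k := by exact_mod_cast hk
  rw [div_le_iff₀ hk', add_mul, one_div, inv_mul_cancel₀ hk'.ne', mul_comm x]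
  have h0 : 0 ≤ (k : ℝ) * x := by positivity
  unfold gridIndex
  rw [Nat.cast_max]
  refine max_le ?_ (Nat.ceil_lt_add_one h0).le
  push_cast
  linarith

/-- The scaled vector of `v`. -/
abbrev scale (k : ℕ) (v : Vec) : Vec := scaled k (boxOf k v)

theorem le_scale {k : ℕ} (hk : 0 < k) (v : Vec) : v ≤ scale k v :=
  ⟨le_gridIndex_div hk _, le_gridIndex_div hk _⟩

theorem scaled_nonneg (k : ℕ) (b : Box) : 0 ≤ scaled k b :=
  ⟨by simp only [scaled, Prod.fst_zero]; positivity,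
    by simp only [scaled, Prod.snd_zero]; positivity⟩

theorem scale_le {k : ℕ} (hk : 0 < k) {v : Vec} (hv : 0 ≤ v) :
    scale k v ≤ v + (1 / (k : ℝ), 1 / (k : ℝ)) :=
  ⟨gridIndex_div_le hk hv.1, gridIndex_div_le hk hv.2⟩

theorem scale_le_one {k : ℕ} (hk : 0 < k) {v : Vec} (hv : v ≤ 1) : scale k v ≤ 1 := by
  have hk' : (0 : ℝ) < k := by exact_mod_cast hk
  have key : ∀ x : ℝ, x ≤ 1 → (gridIndex k x : ℝ) / k ≤ 1 := fun x hx => by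
    rw [div_le_one hk']
    exact_mod_cast gridIndex_le hk hk (by rwa [div_self hk'.ne'])
  exact ⟨key _ hv.1, key _ hv.2⟩

/-- For even k the number 1/2 is a grid line, and rounding up to the grid does not cross it. -/
theorem scale_le_half {k : ℕ} (hk : 0 < k) (hk2 : Even k) {v : Vec} (hv : v ≤ (1 / 2, 1 / 2)) :
    scale k v ≤ (1 / 2, 1 / 2) := by
  obtain ⟨m, rfl⟩ := hk2
  have hm : (0 : ℝ) < m := by exact_mod_cast (by omega : 0 < m)
  have e : (m : ℝ) / (m + m : ℕ) = 1 / 2 := by push_cast; field_simp; norm_num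
  have key : ∀ x : ℝ, x ≤ 1 / 2 → (gridIndex (m + m) x : ℝ) / (m + m : ℕ) ≤ 1 / 2 := fun x hx => by
    rw [← e]
    gcongr
    exact gridIndex_le hk (by omega) (by rwa [e])
  exact ⟨key _ hv.1, key _ hv.2⟩

theorem card_filter_half_lt_le_one {M : Multiset Vec} {φ : Vec → ℝ} (h0 : ∀ v ∈ M, 0 ≤ φ v)
    (hs : (M.map φ).sum ≤ 1) : (M.filter (fun v => 1 / 2 < φ v)).card ≤ 1 := by
  by_contra hcon
  push Not at hcon
  obtain ⟨S, hS, hS2⟩ : ∃ S ≤ M.filter (fun v => 1 / 2 < φ v), S.card = 2 := by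
    have : 0 < (Multiset.powersetCard 2 (M.filter (fun v => 1 / 2 < φ v))).card := by
      rw [Multiset.card_powersetCard]
      exact Nat.choose_pos hcon
    obtain ⟨S, hS⟩ := Multiset.card_pos_iff_exists_mem.1 this
    exact ⟨S, Multiset.mem_powersetCard.1 hS⟩
  obtain ⟨a, b, rfl⟩ := Multiset.card_eq_two.1 hS2
  have ha : 1 / 2 < φ a := (Multiset.mem_filter.1 (Multiset.mem_of_le hS (by simp))).2
  have hb : 1 / 2 < φ b := (Multiset.mem_filter.1 (Multiset.mem_of_le hS (by simp))).2
  obtain ⟨T, rfl⟩ := Multiset.le_iff_exists_add.1 (hS.trans (Multiset.filter_le _ _))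
  have hT := sum_map_nonneg_of (M := T) (φ := φ) fun v hv => h0 v (by simp [hv])
  simp only [Multiset.map_add, Multiset.sum_add, Multiset.insert_eq_cons, Multiset.map_cons,
    Multiset.map_singleton, Multiset.sum_cons, Multiset.sum_singleton] at hs
  linarith

/-- A long vector has a coordinate above 40/k. This limits the total rounding error, both in a bin
of an optimal packing and in a bin of the strategy. -/
theorem card_mul_le_of_not_isShort {k : ℕ} {B : Multiset Vec} (h0 : ∀ v ∈ B, 0 ≤ v)
    (hl : ∀ v ∈ B, ¬ IsShort k v) : B.card * (40 / (k : ℝ)) ≤ B.sum.1 + B.sum.2 := by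
  induction B using Multiset.induction with
  | empty => simp
  | cons v B ih =>
    have ih := ih (fun w hw => h0 w (by simp [hw])) (fun w hw => hl w (by simp [hw]))
    obtain ⟨h1, h2⟩ := h0 v (by simp)
    have h3 := hl v (by simp)
    have : 40 / (k : ℝ) ≤ v.1 + v.2 := by
      rw [not_and_or, not_le, not_le] at h3
      simp only [Prod.fst_zero, Prod.snd_zero] at h1 h2
      rcases h3 with h3 | h3 <;> linarith
    simp only [Multiset.card_cons, Multiset.sum_cons, Prod.fst_add, Prod.snd_add]
    push_cast
    linarith

theorem sum_map_scale_le {k : ℕ} (hk : 0 < k) {B : Multiset Vec} (h0 : ∀ v ∈ B, 0 ≤ v) :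
    (B.map (scale k)).sum ≤ B.sum + (B.card * (1 / (k : ℝ)), B.card * (1 / (k : ℝ))) := by
  induction B using Multiset.induction with
  | empty => simp [Prod.le_def]
  | cons v B ih =>
    have ih := ih (fun w hw => h0 w (by simp [hw]))
    simp only [Multiset.map_cons, Multiset.sum_cons, Multiset.card_cons]
    refine (add_le_add (scale_le hk (h0 v (by simp))) ih).trans (le_of_eq ?_)
    ext <;> simp <;> ring

theorem splitsInThree_map_scale {k : ℕ} (hk : 0 < k) (hk2 : Even k) {B : Multiset Vec}
    (h0 : ∀ v ∈ B, 0 ≤ v) (h1 : ∀ v ∈ B, v ≤ 1) (hl : ∀ v ∈ B, ¬ IsShort k v) (hB : B.sum ≤ 1) :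
    SplitsInThree (B.map (scale k)) := by
  have hk' : (0 : ℝ) < k := by exact_mod_cast hk
  apply splitsInThree
  · simp only [Multiset.mem_map]
    rintro _ ⟨v, -, rfl⟩
    exact scaled_nonneg k _
  · simp only [Multiset.mem_map]
    rintro _ ⟨v, hv, rfl⟩
    exact scale_le_one hk (h1 v hv)
  · refine (sum_map_scale_le hk h0).trans ?_
    -- The right-hand side is at most 2, so `B.card / k` is at most 1/20, which is within the slack
    -- of 1/4.
    have h2 := card_mul_le_of_not_isShort h0 hl
    have e : (B.card : ℝ) * (40 / (k : ℝ)) = 40 * (B.card * (1 / (k : ℝ))) := by ring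
    rw [e] at h2
    obtain ⟨hB1, hB2⟩ := hB
    simp only [Prod.fst_one, Prod.snd_one] at hB1 hB2
    simp only [Prod.le_def, Prod.fst_add, Prod.snd_add]
    constructor <;> linarith
  · rw [Multiset.filter_map, Multiset.card_map]
    obtain ⟨hB1, hB2⟩ := hB
    rw [fst_sum] at hB1
    rw [snd_sum] at hB2
    have c1 := card_filter_half_lt_le_one (fun v hv => (h0 v hv).1) hB1
    have c2 := card_filter_half_lt_le_one (fun v hv => (h0 v hv).2) hB2
    -- A scaled vector outside the half square comes from a vector outside it, and each coordinate
    -- exceeds 1/2 for at most one vector of the bin.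
    have : B.filter ((fun v => ¬ v ≤ (1 / 2, 1 / 2)) ∘ scale k) ≤
        B.filter (fun v => 1 / 2 < v.1) + B.filter (fun v => 1 / 2 < v.2) := by
      rw [Multiset.filter_add_filter (fun v : Vec => 1 / 2 < v.1) (fun v : Vec => 1 / 2 < v.2) B]
      refine le_trans ?_ (Multiset.le_add_right _ _)
      refine Multiset.monotone_filter_right B fun v hv => ?_
      by_contra hcon
      push Not at hcon
      exact hv (scale_le_half hk hk2 ⟨hcon.1, hcon.2⟩)
    have := Multiset.card_le_card this
    rw [Multiset.card_add] at this
    omega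

/-! ### Optimal packings -/

theorem norm_le_one_iff_of_nonneg {v : Vec} (h : 0 ≤ v) : ‖v‖ ≤ 1 ↔ v ≤ 1 := by
  rw [Prod.norm_def, max_le_iff, Prod.le_def, Real.norm_of_nonneg h.1, Real.norm_of_nonneg h.2]
  rfl

theorem opt_le {P : List (Multiset Vec)} {S : Multiset Vec} (h : IsPacking P S) :
    opt S ≤ P.length := Nat.sInf_le ⟨P, h, rfl⟩

/-- One bin per vector: this makes the set in the definition of `opt` nonempty, so that the infimum
is attained, and it bounds the range of the exhaustive search. -/
theorem isPacking_singletons {S : Multiset Vec} (h : ∀ v ∈ S, ‖v‖ ≤ 1) :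
    IsPacking (S.toList.map fun v => {v}) S := by
  refine ⟨?_, ?_⟩
  · have : ∀ l : List Vec, (l.map fun v => ({v} : Multiset Vec)).sum = l := fun l => by
      induction l with
      | nil => rfl
      | cons a l ih => simp [ih]
    rw [this, Multiset.coe_toList]
  · simp only [List.mem_map, Multiset.mem_toList]
    rintro _ ⟨v, hv, rfl⟩
    simpa using h v hv

theorem opt_le_card {S : Multiset Vec} (h : ∀ v ∈ S, ‖v‖ ≤ 1) : opt S ≤ S.card := by
  simpa using opt_le (isPacking_singletons h)

theorem exists_packing_length_eq_opt {S : Multiset Vec} (h : ∀ v ∈ S, ‖v‖ ≤ 1) :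
    ∃ P, IsPacking P S ∧ P.length = opt S :=
  Nat.sInf_mem (s := {m | ∃ P, IsPacking P S ∧ P.length = m}) ⟨_, _, isPacking_singletons h, rfl⟩

theorem mem_of_mem_list_sum {α : Type*} {P : List (Multiset α)} {B : Multiset α} (hB : B ∈ P)
    {a : α} (ha : a ∈ B) : a ∈ P.sum := by
  induction P with
  | nil => simp at hB
  | cons C P ih =>
    rw [List.sum_cons, Multiset.mem_add]
    rcases List.mem_cons.1 hB with rfl | hB
    · exact Or.inl ha
    · exact Or.inr (ih hB)

theorem longBoxes_map_scaled (k : ℕ) (σ : List Vec) : (longBoxes k σ).map (scaled k) =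
    (((σ : Multiset Vec).filter fun v => ¬ IsShort k v).map (scale k)) := by
  simp only [longBoxes, Multiset.map_coe, Multiset.filter_coe, List.map_map]
  rfl

theorem two_mul_opt_longBoxes_le {k : ℕ} (hk : 0 < k) (hk2 : Even k) {σ : List Vec}
    (hσ : ∀ v ∈ σ, v ∈ Set.Icc (0 : ℝ × ℝ) 1) :
    2 * opt ((longBoxes k σ).map (scaled k)) ≤ 5 * opt (σ : Multiset Vec) + 1 := by
  obtain ⟨P, ⟨hPs, hP⟩, hPl⟩ := exists_packing_length_eq_opt (S := (σ : Multiset Vec))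
    fun v hv => (norm_le_one_iff_of_nonneg (hσ v hv).1).2 (hσ v hv).2
  have hmem : ∀ B ∈ P, ∀ v ∈ B, v ∈ Set.Icc (0 : ℝ × ℝ) 1 := fun B hB v hv =>
    hσ v (by simpa [hPs] using mem_of_mem_list_sum hB hv)
  let φ : Multiset Vec → Multiset Vec := fun B => (B.filter fun v => ¬ IsShort k v).map (scale k)
  have hφ : ∀ P : List (Multiset Vec), (P.map φ).sum = φ P.sum := fun P => by
    induction P with
    | nil => simp [φ]
    | cons B P ih => simp only [List.map_cons, List.sum_cons, ih]; simp [φ]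
  obtain ⟨Q, hQs, hQ, hQl⟩ := exists_packing_of_splitsInThree (P.map φ) (by
    simp only [List.mem_map]
    rintro _ ⟨B, hB, rfl⟩
    have hsub : ∀ v ∈ B.filter fun v => ¬ IsShort k v, v ∈ B := fun v hv =>
      Multiset.mem_of_mem_filter hv
    refine splitsInThree_map_scale hk hk2 (fun v hv => (hmem B hB v (hsub v hv)).1)
      (fun v hv => (hmem B hB v (hsub v hv)).2) (fun v hv => (Multiset.mem_filter.1 hv).2) ?_
    have hB0 : ∀ v ∈ B, 0 ≤ v := fun v hv => (hmem B hB v hv).1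
    refine le_trans ?_ ((norm_le_one_iff_of_nonneg (Multiset.sum_nonneg hB0)).1 (hP B hB))
    conv_rhs => rw [← Multiset.filter_add_not (fun v => ¬ IsShort k v) B, Multiset.sum_add]
    exact le_add_of_nonneg_right (Multiset.sum_nonneg fun v hv =>
      hB0 v (Multiset.mem_of_mem_filter hv)))
  rw [hφ, hPs] at hQs
  rw [List.length_map, hPl] at hQl
  have : IsPacking Q ((longBoxes k σ).map (scaled k)) := by
    rw [longBoxes_map_scaled]
    refine ⟨hQs, fun B hB => (norm_le_one_iff_of_nonneg (Multiset.sum_nonneg fun v hv => ?_)).2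
      (hQ B hB)⟩
    have := mem_of_mem_list_sum hB hv
    rw [hQs] at this
    simp only [φ, Multiset.mem_map] at this
    obtain ⟨w, -, rfl⟩ := this
    exact scaled_nonneg k _
  have := opt_le this
  omega

/-! ### Invariants of the strategy -/

theorem l1_of_nonneg {v : Vec} (h : 0 ≤ v) : l1 v = v.1 + v.2 := by
  rw [l1, abs_of_nonneg h.1, abs_of_nonneg h.2]

theorem serve_cases (k : ℕ) (bins : List Bin) (v : Vec) :
    (∃ l₁ B l₂, bins = l₁ ++ B :: l₂ ∧ accepts k v B = true ∧
      serve k bins v = l₁ ++ addTo k v B :: l₂) ∨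
    ((∀ B ∈ bins, accepts k v B = false) ∧ serve k bins v = bins ++ [newBin v]) := by
  by_cases h : choice k bins v < bins.length
  · left
    refine ⟨bins.take (choice k bins v), bins[choice k bins v], bins.drop (choice k bins v + 1),
      ?_, List.findIdx_getElem (w := h), ?_⟩
    · rw [List.getElem_cons_drop, List.take_append_drop]
    · rw [serve, if_pos h, List.modify_eq_take_cons_drop h]
  · right
    refine ⟨?_, by rw [serve, if_neg h]⟩
    have := List.findIdx_eq_length.1 (le_antisymm List.findIdx_le_length (not_lt.1 h))
    simpa using this

/-- The sum of the scaled vectors for which places are still reserved. -/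
def Bin.reserved (k : ℕ) (B : Bin) : Vec := (B.slots.map (scaled k)).sum

/-- The number of long vectors in a bin. -/
def Bin.longCount (k : ℕ) (B : Bin) : ℕ := (B.content.filter fun v => ¬ IsShort k v).card

/-- What holds for each bin at any time. -/
structure Bin.Inv (k : ℕ) (B : Bin) : Prop where
  nonneg : ∀ v ∈ B.content, 0 ≤ v
  vload_eq : B.vload = (B.reserved k).1 + (B.reserved k).2 + (B.content.sum.1 + B.content.sum.2)
  fits : B.content.sum + B.reserved k ≤ 1

theorem Bin.reserved_nonneg (k : ℕ) (B : Bin) : 0 ≤ B.reserved k :=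
  Multiset.sum_nonneg fun v hv => by
    obtain ⟨b, -, rfl⟩ := Multiset.mem_map.1 hv
    exact scaled_nonneg k b

theorem Bin.Inv.longCount_mul_le {k : ℕ} {B : Bin} (h : B.Inv k) :
    B.longCount k * (40 / (k : ℝ)) ≤ B.content.sum.1 + B.content.sum.2 := by
  have h1 := card_mul_le_of_not_isShort (k := k)
    (B := B.content.filter fun v => ¬ IsShort k v)
    (fun v hv => h.nonneg v (Multiset.mem_filter.1 hv).1) (fun v hv => (Multiset.mem_filter.1 hv).2)
  have h2 : 0 ≤ (B.content.filter fun v => ¬ ¬ IsShort k v).sum :=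
    Multiset.sum_nonneg fun v hv => h.nonneg v (Multiset.mem_filter.1 hv).1
  have h3 := congrArg Multiset.sum (Multiset.filter_add_not (fun v => ¬ IsShort k v) B.content)
  rw [Multiset.sum_add] at h3
  rw [← h3]
  obtain ⟨h4, h5⟩ := h2
  simp only [Prod.fst_add, Prod.snd_add, Prod.fst_zero, Prod.snd_zero, Bin.longCount] at *
  linarith

theorem newBin_inv (k : ℕ) {v : Vec} (hv : v ∈ Set.Icc (0 : ℝ × ℝ) 1) : (newBin v).Inv k where
  nonneg := by simpa [newBin] using hv.1
  vload_eq := by simp [newBin, Bin.reserved, l1_of_nonneg hv.1]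
  fits := by simpa [newBin, Bin.reserved] using hv.2

theorem criticalBin_inv {k : ℕ} {t : Multiset Box} (ht : ‖(t.map (scaled k)).sum‖ ≤ 1) :
    (criticalBin k t).Inv k where
  nonneg := by simp [criticalBin]
  vload_eq := by
    simp only [criticalBin, Bin.reserved, Multiset.sum_zero, Prod.fst_zero, Prod.snd_zero, add_zero]
    rw [fst_sum, snd_sum, ← Multiset.sum_map_add, Multiset.map_map]
    exact congrArg _ (Multiset.map_congr rfl fun b _ => l1_of_nonneg (scaled_nonneg k b))
  fits := by
    have := Bin.reserved_nonneg k (criticalBin k t)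
    simpa [criticalBin, Bin.reserved] using (norm_le_one_iff_of_nonneg this).1 ht

theorem reserved_addTo_of_long {k : ℕ} {v : Vec} {B : Bin} (hs : ¬ IsShort k v)
    (ha : accepts k v B = true) : (addTo k v B).reserved k + scale k v = B.reserved k := by
  have hm : boxOf k v ∈ B.slots := by simpa [accepts, hs] using ha
  rw [Bin.reserved, Bin.reserved, addTo, if_neg hs, add_comm, scale,
    ← Multiset.sum_cons, ← Multiset.map_cons, Multiset.cons_erase hm]

/-- For a short vector the test bounds even the L₁-norm of content and reserved vectors by 1, hence
both coordinates. A long vector replaces a scaled vector that dominates it, and the virtual load is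
corrected by exactly the difference of the norms. -/
theorem addTo_inv {k : ℕ} (hk : 0 < k) {v : Vec} {B : Bin} (hv : 0 ≤ v)
    (ha : accepts k v B = true) (hB : B.Inv k) : (addTo k v B).Inv k := by
  have hn : ∀ w ∈ (addTo k v B).content, 0 ≤ w := by
    have : (addTo k v B).content = v ::ₘ B.content := by unfold addTo; split_ifs <;> rfl
    rw [this]
    simpa using ⟨hv, fun a b h => hB.nonneg _ h⟩
  by_cases hs : IsShort k v
  · have h1 : B.vload + l1 v ≤ 1 := by
      rw [accepts, if_pos hs] at ha
      exact of_decide_eq_true ha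
    have h2 : addTo k v B = ⟨B.slots, B.vload + l1 v, v ::ₘ B.content⟩ := if_pos hs
    have h3 := Bin.reserved_nonneg k B
    have h4 : 0 ≤ B.content.sum := Multiset.sum_nonneg hB.nonneg
    have h5 := hB.vload_eq
    obtain ⟨h3, h3'⟩ := h3
    obtain ⟨h4, h4'⟩ := h4
    obtain ⟨hv1, hv2⟩ := id hv
    rw [l1_of_nonneg hv] at h1
    refine ⟨hn, ?_, ?_⟩
    · simp only [h2, Bin.reserved, l1_of_nonneg hv, Multiset.sum_cons, Prod.fst_add,
        Prod.snd_add] at h5 ⊢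
      linarith
    · simp only [h2, Bin.reserved, Multiset.sum_cons, Prod.le_def, Prod.fst_add, Prod.snd_add,
        Prod.fst_zero, Prod.snd_zero, Prod.fst_one, Prod.snd_one] at *
      constructor <;> linarith
  · have h2 : addTo k v B = ⟨B.slots.erase (boxOf k v),
      B.vload - (l1 (scaled k (boxOf k v)) - l1 v), v ::ₘ B.content⟩ := if_neg hs
    have h3 := reserved_addTo_of_long hs ha
    have h4 := hB.vload_eq
    have h5 := hB.fits
    obtain ⟨h6, h7⟩ := le_scale hk v
    have hl : (addTo k v B).vload = B.vload - ((scale k v).1 + (scale k v).2 - (v.1 + v.2)) := by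
      rw [h2, ← l1_of_nonneg hv, ← l1_of_nonneg (scaled_nonneg k _)]
    have hc : (addTo k v B).content.sum = v + B.content.sum := by rw [h2]; simp
    rw [← h3] at h4 h5
    refine ⟨hn, ?_, ?_⟩
    · rw [hl, hc, h4]
      simp only [Prod.fst_add, Prod.snd_add]
      ring
    · rw [hc]
      simp only [Prod.le_def, Prod.fst_add, Prod.snd_add, Prod.fst_one, Prod.snd_one] at h5 ⊢
      constructor <;> linarith

/-- The virtual load, corrected for the rounding of the long vectors in the bin. -/
def Bin.potential (k : ℕ) (B : Bin) : ℝ := B.vload + 2 / k * B.longCount k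

/-- A long vector lowers the virtual load by its rounding error, at most 1/k per coordinate, and
this is paid for by the 2/k that the increased long count contributes. -/
theorem potential_le_addTo {k : ℕ} (hk : 0 < k) {v : Vec} {B : Bin} (hv : 0 ≤ v) :
    B.potential k ≤ (addTo k v B).potential k := by
  by_cases hs : IsShort k v
  · have h1 : (addTo k v B).longCount k = B.longCount k := by
      rw [addTo, if_pos hs, Bin.longCount, Bin.longCount,
        Multiset.filter_cons_of_neg (p := fun v => ¬ IsShort k v) _ (not_not.2 hs)]
    have h2 : (addTo k v B).vload = B.vload + l1 v := by rw [addTo, if_pos hs]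
    have h3 : 0 ≤ l1 v := by unfold l1; positivity
    rw [Bin.potential, Bin.potential, h1, h2]
    linarith
  · have h1 : (addTo k v B).longCount k = B.longCount k + 1 := by
      rw [addTo, if_neg hs, Bin.longCount, Bin.longCount,
        Multiset.filter_cons_of_pos (p := fun v => ¬ IsShort k v) _ hs, Multiset.card_cons]
    have h2 : (addTo k v B).vload = B.vload - (l1 (scaled k (boxOf k v)) - l1 v) := by
      rw [addTo, if_neg hs]
    obtain ⟨h3, h4⟩ := scale_le hk hv
    rw [Bin.potential, Bin.potential, h1, h2, l1_of_nonneg hv, l1_of_nonneg (scaled_nonneg k _)]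
    simp only [Prod.fst_add, Prod.snd_add] at h3 h4
    have e : 2 / (k : ℝ) * ((B.longCount k + 1 : ℕ) : ℝ) =
      2 / (k : ℝ) * B.longCount k + 1 / k + 1 / k := by push_cast; ring
    rw [e]
    linarith

/-- A bin that is too empty to be counted as well filled. -/
def Bin.Poor (k : ℕ) (B : Bin) : Prop := B.potential k < 1 - 80 / k

open Classical in
/-- What holds for the open bins at any time. `m` is the number of critical bins, `S` consists of
all vectors, and `τ` of those that are not served yet. -/
structure BinsInv (k m : ℕ) (S : Multiset Vec) (bins : List Bin) (τ : List Vec) : Prop where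
  inv : ∀ B ∈ bins, B.Inv k
  slots : (bins.map Bin.slots).sum = longBoxes k τ
  content : (bins.map Bin.content).sum + (τ : Multiset Vec) = S
  length : bins.length = m ∨ bins.countP (fun B => B.Poor k) ≤ 1

theorem longBoxes_cons (k : ℕ) (v : Vec) (τ : List Vec) : longBoxes k (v :: τ) =
    if IsShort k v then longBoxes k τ else boxOf k v ::ₘ longBoxes k τ := by
  by_cases h : IsShort k v
  · rw [if_pos h, longBoxes, List.filter_cons_of_neg (by simpa using h), longBoxes]
  · rw [if_neg h, longBoxes, List.filter_cons_of_pos (p := fun v => decide (¬ IsShort k v)) (decide_eq_true h),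
      longBoxes]
    rfl

/-- The unused places match the long vectors still to come, so a long vector always finds its place
and only a short one can open a bin. When it does, all other bins have rejected it and are not poor,
which leaves the new bin as the only possibly poor one. Later no bin becomes poor, since potentials
do not decrease. -/
theorem BinsInv.serve {k m : ℕ} (hk : 0 < k) {S : Multiset Vec} {bins : List Bin} {v : Vec}
    {τ : List Vec} (hv : v ∈ Set.Icc (0 : ℝ × ℝ) 1) (h : BinsInv k m S bins (v :: τ)) :
    BinsInv k m S (serve k bins v) τ := by
  classical
  obtain ⟨h1, h2, h3, h4⟩ := h
  rw [longBoxes_cons] at h2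
  rw [← Multiset.cons_coe] at h3
  rcases serve_cases k bins v with ⟨l₁, B, l₂, rfl, ha, hs⟩ | ⟨ha, hs⟩ <;> rw [hs]
  · have hc : (addTo k v B).content = v ::ₘ B.content := by unfold addTo; split_ifs <;> rfl
    refine ⟨?_, ?_, ?_, ?_⟩
    · intro C hC
      simp only [List.mem_append, List.mem_cons] at hC
      rcases hC with hC | rfl | hC
      · exact h1 C (by simp [hC])
      · exact addTo_inv hk hv.1 ha (h1 B (by simp))
      · exact h1 C (by simp [hC])
    · simp only [List.map_append, List.map_cons, List.sum_append, List.sum_cons] at h2 ⊢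
      by_cases hv : IsShort k v
      · rw [if_pos hv] at h2
        rw [← h2, addTo, if_pos hv]
      · have hm : boxOf k v ∈ B.slots := by simpa [accepts, hv] using ha
        rw [if_neg hv, ← Multiset.cons_erase hm] at h2
        rw [addTo, if_neg hv]
        apply (Multiset.cons_inj_right (boxOf k v)).1
        rw [← h2]
        simp only [← Multiset.singleton_add]
        abel
    · rw [← h3]
      simp only [List.map_append, List.map_cons, List.sum_append, List.sum_cons, hc,
        ← Multiset.singleton_add]
      abel
    · rcases h4 with h4 | h4
      · left; simpa using h4
      · right
        refine le_trans ?_ h4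
        simp only [List.countP_append, List.countP_cons]
        have : (addTo k v B).Poor k → B.Poor k := (potential_le_addTo hk hv.1).trans_lt
        gcongr
        by_cases hp : (addTo k v B).Poor k
        · simp [hp, this hp]
        · simp [hp]
  · have hsh : IsShort k v := by
      by_contra hv
      rw [if_neg hv] at h2
      have hm : boxOf k v ∈ (bins.map Bin.slots).sum := by rw [h2]; simp
      have : ∀ l : List Bin, boxOf k v ∈ (l.map Bin.slots).sum → ∃ B ∈ l, boxOf k v ∈ B.slots := by
        intro l
        induction l with
        | nil => simp
        | cons B l ih =>
          rw [List.map_cons, List.sum_cons, Multiset.mem_add]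
          rintro (h | h)
          · exact ⟨B, by simp, h⟩
          · obtain ⟨C, hC, hC'⟩ := ih h
            exact ⟨C, by simp [hC], hC'⟩
      obtain ⟨B, hB, hB'⟩ := this bins hm
      have := ha B hB
      rw [accepts, if_neg hv] at this
      simp [hB'] at this
    rw [if_pos hsh] at h2
    refine ⟨?_, ?_, ?_, ?_⟩
    · intro C hC
      rcases List.mem_append.1 hC with hC | hC
      · exact h1 C hC
      · rw [List.mem_singleton.1 hC]
        exact newBin_inv k hv
    · simpa [newBin] using h2
    · rw [← h3]
      simp only [List.map_append, List.map_cons, List.map_nil, List.sum_append, List.sum_cons,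
        List.sum_nil, newBin, add_zero, ← Multiset.singleton_add]
      abel
    · right
      have : bins.countP (fun B => B.Poor k) = 0 := by
        rw [List.countP_eq_zero]
        intro B hB
        have h5 := ha B hB
        rw [accepts, if_pos hsh, decide_eq_false_iff_not, not_le, l1_of_nonneg hv.1] at h5
        have h6 : (0 : ℝ) ≤ 2 / k * B.longCount k := by positivity
        -- Both coordinates of a short vector are at most 40/k; this is the origin of the threshold
        -- in `Bin.Poor`.
        have h7 : 80 / (k : ℝ) = 40 / k + 40 / k := by ring
        have h8 : ¬ B.Poor k := by
          rw [Bin.Poor, Bin.potential, not_lt]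
          linarith [hsh.1, hsh.2]
        simpa using h8
      rw [List.countP_append, this, zero_add]
      exact List.countP_le_length

theorem BinsInv.foldl {k m : ℕ} (hk : 0 < k) {S : Multiset Vec} : ∀ {τ : List Vec}
    {bins : List Bin}, (∀ v ∈ τ, v ∈ Set.Icc (0 : ℝ × ℝ) 1) → BinsInv k m S bins τ →
    BinsInv k m S (τ.foldl (VectorPacking.serve k) bins) []
  | [], _, _, h => h
  | v :: τ, bins, hτ, h => by
    rw [List.foldl_cons]
    exact BinsInv.foldl hk (fun w hw => hτ w (by simp [hw])) (h.serve hk (hτ v (by simp)))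

theorem binsInv_criticalBins {k : ℕ} {P : List (Multiset Box)} {σ : List Vec}
    (hP : IsOptimalBoxPacking k P (longBoxes k σ)) :
    BinsInv k P.length (σ : Multiset Vec) (criticalBins k P) σ where
  inv := by
    simp only [criticalBins, List.mem_map]
    rintro _ ⟨t, ht, rfl⟩
    exact criticalBin_inv (hP.2.1.2 _ (List.mem_map_of_mem ht))
  slots := by
    rw [criticalBins, List.map_map, ← hP.1]
    exact congrArg _ (List.map_id P)
  content := by
    have : ∀ P : List (Multiset Box), ((criticalBins k P).map Bin.content).sum = 0 := by
      intro P
      induction P with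
      | nil => rfl
      | cons t P ih =>
        rw [criticalBins, List.map_cons, List.map_cons, List.sum_cons]
        exact (zero_add _).trans ih
    rw [this, zero_add]
  length := by simp [criticalBins]

/-! ### Total load and the number of bins -/

theorem sum_le_two_mul_opt {σ : List Vec} (hσ : ∀ v ∈ σ, v ∈ Set.Icc (0 : ℝ × ℝ) 1) :
    (σ : Multiset Vec).sum.1 + (σ : Multiset Vec).sum.2 ≤ 2 * opt (σ : Multiset Vec) := by
  obtain ⟨P, ⟨hPs, hP⟩, hPl⟩ := exists_packing_length_eq_opt (S := (σ : Multiset Vec))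
    fun v hv => (norm_le_one_iff_of_nonneg (hσ v hv).1).2 (hσ v hv).2
  rw [← hPl, ← hPs]
  clear hPl hPs
  induction P with
  | nil => simp
  | cons B P ih =>
    have h1 := ih fun C hC => hP C (by simp [hC])
    have h2 := hP B (by simp)
    rw [Prod.norm_def, max_le_iff] at h2
    have h3 := (le_abs_self _).trans h2.1
    have h4 := (le_abs_self _).trans h2.2
    simp only [List.sum_cons, Multiset.sum_add, Prod.fst_add, Prod.snd_add, List.length_cons]
    push_cast
    linarith

/-- Without reserved places the virtual load is the L₁-norm L of the content. There are at most
(k/40)·L long vectors, so the potential is at most (21/20)·L, and it is at least 1 - 80/k ≥ 7/8.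
This even gives L ≥ 5/6. -/
theorem four_fifths_le_of_not_poor {k : ℕ} (hk : 640 ≤ k) {B : Bin} (hB : B.Inv k)
    (hs : B.slots = 0) (hp : ¬ B.Poor k) : 4 / 5 ≤ B.content.sum.1 + B.content.sum.2 := by
  have hk' : (640 : ℝ) ≤ k := by exact_mod_cast hk
  have h1 := hB.vload_eq
  have h2 := hB.longCount_mul_le
  have h3 : 80 / (k : ℝ) ≤ 1 / 8 := by rw [div_le_iff₀ (by linarith)]; linarith
  have h4 : 2 / (k : ℝ) * B.longCount k = (B.longCount k * (40 / (k : ℝ))) / 20 := by ring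
  simp only [Bin.reserved, hs, Multiset.map_zero, Multiset.sum_zero, Prod.fst_zero,
    Prod.snd_zero] at h1
  rw [Bin.Poor, Bin.potential, not_lt, h4] at hp
  linarith

theorem list_sum_eq_zero_imp {α : Type*} {l : List (Multiset α)} (h : l.sum = 0) :
    ∀ t ∈ l, t = 0 := fun t ht => Multiset.eq_zero_of_forall_notMem fun a ha => by
  simpa [h] using mem_of_mem_list_sum ht ha

open Classical in
theorem four_fifths_mul_le_sum {k : ℕ} (hk : 640 ≤ k) : ∀ {bins : List Bin},
    (∀ B ∈ bins, B.Inv k) → (∀ B ∈ bins, B.slots = 0) →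
    4 / 5 * ((bins.length : ℝ) - bins.countP (fun B => B.Poor k)) ≤
      (bins.map Bin.content).sum.sum.1 + (bins.map Bin.content).sum.sum.2
  | [], _, _ => by simp
  | B :: bins, h1, h2 => by
    have ih := four_fifths_mul_le_sum hk (fun C hC => h1 C (List.mem_cons_of_mem _ hC))
      (fun C hC => h2 C (List.mem_cons_of_mem _ hC))
    have hB := h1 B (by simp)
    obtain ⟨h3, h4⟩ := Multiset.sum_nonneg hB.nonneg
    simp only [Prod.fst_zero, Prod.snd_zero] at h3 h4
    simp only [List.map_cons, List.sum_cons, Multiset.sum_add, Prod.fst_add, Prod.snd_add,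
      List.length_cons, List.countP_cons]
    by_cases hp : B.Poor k
    · simp only [hp, decide_true, if_true]
      push_cast
      linarith
    · have := four_fifths_le_of_not_poor hk hB (h2 B (by simp)) hp
      simp only [hp, decide_false, Bool.false_eq_true, if_false]
      push_cast
      linarith

theorem isPacking_finalBins {k : ℕ} (hk : 0 < k) {σ : List Vec}
    (hσ : ∀ v ∈ σ, v ∈ Set.Icc (0 : ℝ × ℝ) 1) {P : List (Multiset Box)}
    (hP : IsOptimalBoxPacking k P (longBoxes k σ)) :
    IsPacking ((finalBins k P σ).map Bin.content) (σ : Multiset Vec) := by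
  obtain ⟨h1, -, h3, -⟩ := (binsInv_criticalBins hP).foldl hk hσ
  refine ⟨by simpa [finalBins] using h3, ?_⟩
  simp only [List.mem_map]
  rintro _ ⟨B, hB, rfl⟩
  have hB := h1 B hB
  exact (norm_le_one_iff_of_nonneg (Multiset.sum_nonneg hB.nonneg)).2
    ((le_add_of_nonneg_right (Bin.reserved_nonneg k B)).trans hB.fits)

theorem length_finalBins_le {k : ℕ} (hk : 640 ≤ k) (hk2 : Even k) {σ : List Vec}
    (hσ : ∀ v ∈ σ, v ∈ Set.Icc (0 : ℝ × ℝ) 1) {P : List (Multiset Box)}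
    (hP : IsOptimalBoxPacking k P (longBoxes k σ)) :
    ((finalBins k P σ).length : ℝ) ≤ 5 / 2 * (opt (σ : Multiset Vec) : ℝ) + 1 := by
  classical
  obtain ⟨h1, h2, h3, h4⟩ := (binsInv_criticalBins hP).foldl (by omega) hσ
  change _ ∨ (finalBins k P σ).countP _ ≤ 1 at h4
  rcases h4 with h4 | h4
  -- Only critical bins are open: the repacking argument bounds their number.
  · change (finalBins k P σ).length = _ at h4
    have h5 := two_mul_opt_longBoxes_le (k := k) (by omega) hk2 hσ
    rw [← hP.2.2, ← h4] at h5
    have h6 : (2 : ℝ) * (finalBins k P σ).length ≤ 5 * opt (σ : Multiset Vec) + 1 := by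
      exact_mod_cast h5
    linarith
  -- At most one bin is poor. No long vectors are left to come, so no places are reserved any more,
  -- and the volume argument applies.
  · have h5 := list_sum_eq_zero_imp (h2.trans (by simp [longBoxes]))
    have h6 := four_fifths_mul_le_sum hk h1 fun B hB => h5 _ (List.mem_map_of_mem hB)
    rw [Multiset.coe_nil, add_zero] at h3
    rw [h3] at h6
    have h7 := sum_le_two_mul_opt hσ
    have h8 : ((finalBins k P σ).countP (fun B => B.Poor k) : ℝ) ≤ 1 := by exact_mod_cast h4
    change 4 / 5 * (((finalBins k P σ).length : ℝ) - (finalBins k P σ).countP _) ≤ _ at h6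
    linarith

/-! ### The length of the advice -/

theorem length_binary (w m : ℕ) : (binary w m).length = w := by simp [binary]

theorem length_allBoxes (k : ℕ) : (allBoxes k).length = k * k := by
  exact (List.length_product _ _).trans (by simp)

theorem length_flatMap_binary {α : Type*} (w : ℕ) (f : α → ℕ) (l : List α) :
    (l.flatMap fun b => binary w (f b)).length = l.length * w := by
  simp [List.length_flatMap, length_binary]

theorem length_advice (k : ℕ) (σ : List Vec) : (advice k σ).length =
    2 * Nat.size (k * k * Nat.size σ.length) + 1 + k * k * Nat.size σ.length := by
  simp only [advice, selfDelimiting, List.length_append, List.length_replicate, List.length_cons,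
    List.length_nil, length_binary, length_flatMap_binary, length_allBoxes]
  ring

theorem size_le_self (n : ℕ) : n.size ≤ n := Nat.size_le.2 Nat.lt_two_pow_self

/-- Both `n.size - 1` and 1 are at most log₂ n, so the size is at most 2 log₂ n, and 2 / log 2 < 3.
-/
theorem size_le_log {n : ℕ} (hn : 2 ≤ n) : (n.size : ℝ) ≤ 3 * Real.log n := by
  have hn' : (2 : ℝ) ≤ n := by exact_mod_cast hn
  have h1 : 2 ^ (n.size - 1) ≤ n := Nat.lt_size.1 (by
    have : 0 < n.size := Nat.size_pos.2 (by omega)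
    omega)
  have h2 : ((n.size - 1 : ℕ) : ℝ) * Real.log 2 ≤ Real.log n := by
    rw [← Real.log_pow]
    exact Real.log_le_log (by positivity) (by exact_mod_cast h1)
  have h3 : Real.log 2 ≤ Real.log n := Real.log_le_log (by norm_num) hn'
  have h4 : (n.size : ℝ) ≤ (n.size - 1 : ℕ) + 1 := by exact_mod_cast (by omega)
  have h5 := Real.log_two_gt_d9
  have h6 : (0 : ℝ) ≤ (n.size - 1 : ℕ) := by positivity
  nlinarith

theorem length_advice_le (k : ℕ) : ∃ C : ℝ, ∀ σ : List Vec, 2 ≤ σ.length →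
    ((advice k σ).length : ℝ) ≤ C * Real.log σ.length := by
  refine ⟨3 * (k * k * 3 + 1), fun σ hσ => ?_⟩
  have h1 := size_le_log hσ
  have h2 : 1 ≤ σ.length.size := Nat.size_pos.2 (by omega)
  have h3 : (advice k σ).length ≤ (k * k * 3 + 1) * σ.length.size := by
    rw [length_advice]
    have := size_le_self (k * k * σ.length.size)
    nlinarith
  calc ((advice k σ).length : ℝ) ≤ (k * k * 3 + 1) * σ.length.size := by exact_mod_cast h3
    _ ≤ (k * k * 3 + 1) * (3 * Real.log σ.length) := by gcongr
    _ = _ := by ring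

section programs

/-! ### Total correctness of programs with a bound on the running time -/

/-- Started in `s`, the program `p` halts after at most `T` steps in a configuration that
satisfies `Q`. -/
def Tot (tape : ℕ → Bool) (p : Prog) (s : Config) (T : ℕ) (Q : Config → Prop) : Prop :=
  ∃ t s', t ≤ T ∧ Exec tape p s t s' ∧ Q s'

variable {tape : ℕ → Bool} {p q : Prog} {s : Config} {T T' : ℕ} {Q R : Config → Prop}

theorem Tot.mono (h : Tot tape p s T Q) (hT : T ≤ T') (hQ : ∀ s', Q s' → R s') :
    Tot tape p s T' R := by
  obtain ⟨t, s', ht, he, hq⟩ := h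
  exact ⟨t, s', ht.trans hT, he, hQ s' hq⟩

theorem Tot.skip (h : Q s) : Tot tape .skip s 1 Q := ⟨1, s, le_rfl, .skip s, h⟩

theorem Tot.setN {a e : NExp}
    (h : Q { s with nat := Function.update s.nat (a.eval s) (e.eval s) }) :
    Tot tape (.setN a e) s 1 Q := ⟨1, _, le_rfl, .setN a e s, h⟩

theorem Tot.setR {a : NExp} {e : RExp}
    (h : Q { s with real := Function.update s.real (a.eval s) (e.eval s) }) :
    Tot tape (.setR a e) s 1 Q := ⟨1, _, le_rfl, .setR a e s, h⟩

theorem Tot.readBit {a : NExp}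
    (h : Q { s with nat := Function.update s.nat (a.eval s) (tape s.head).toNat,
                    head := s.head + 1 }) :
    Tot tape (.readBit a) s 1 Q := ⟨1, _, le_rfl, .readBit a s, h⟩

theorem Tot.seq (h : Tot tape p s T R) (h' : ∀ s', R s' → Tot tape q s' T' Q) :
    Tot tape (.seq p q) s (T + T') Q := by
  obtain ⟨t, s', ht, he, hr⟩ := h
  obtain ⟨t', s'', ht', he', hq⟩ := h' s' hr
  exact ⟨t + t', s'', add_le_add ht ht', .seq he he', hq⟩

theorem Tot.seq_self (h : Tot tape p s T fun s' => Tot tape q s' T' Q) :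
    Tot tape (.seq p q) s (T + T') Q := Tot.seq h fun _ h => h

theorem Tot.ite {b : Test} (h : b.Holds s → Tot tape p s T Q) (h' : ¬ b.Holds s → Tot tape q s T Q) :
    Tot tape (.ite b p q) s (1 + T) Q := by
  by_cases hb : b.Holds s
  · obtain ⟨t, s', ht, he, hq⟩ := h hb
    exact ⟨1 + t, s', by omega, .iteTrue hb he, hq⟩
  · obtain ⟨t, s', ht, he, hq⟩ := h' hb
    exact ⟨1 + t, s', by omega, .iteFalse hb he, hq⟩

/-- The invariant is indexed by the number of completed iterations, and `n` is their exact number.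
Each costs one step for the test in addition to the body, and the failing test costs one more. The
induction is on the number of iterations still to be done. -/
theorem Tot.loop {b : Test} (I : ℕ → Config → Prop) (n : ℕ) (h0 : I 0 s)
    (hstep : ∀ i < n, ∀ s, I i s → b.Holds s ∧ Tot tape p s T (I (i + 1)))
    (hend : ∀ s, I n s → ¬ b.Holds s) (hQ : ∀ s, I n s → Q s) :
    Tot tape (.loop b p) s (n * (T + 1) + 1) Q := by
  have key : ∀ j ≤ n, ∀ s, I (n - j) s → Tot tape (.loop b p) s (j * (T + 1) + 1) Q := by
    intro j
    induction j with
    | zero => exact fun _ s hs => ⟨1, s, by omega, .loopEnd (hend s hs), hQ s hs⟩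
    | succ j ih =>
      intro hj s hs
      obtain ⟨hb, t, s', ht, he, hi⟩ := hstep _ (by omega) s hs
      rw [show n - (j + 1) + 1 = n - j by omega] at hi
      obtain ⟨t', s'', ht', he', hq⟩ := ih (by omega) s' hi
      exact ⟨1 + t + t', s'', by nlinarith, .loopStep hb he he', hq⟩
  exact key n le_rfl s (by simpa using h0)

/-! ### Expressions and tests -/

/-- The content of a cell with a fixed address. -/
abbrev NExp.at (a : ℕ) : NExp := .cell (.const a)

attribute [simp] NExp.eval RExp.eval Test.Holds

/-- A multiple of an expression. -/
def NExp.mulC : ℕ → NExp → NExp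
  | 0, _ => .const 0
  | c + 1, e => .add (mulC c e) e

@[simp] theorem NExp.eval_mulC (s : Config) (c : ℕ) (e : NExp) :
    (mulC c e).eval s = c * e.eval s := by
  induction c with
  | zero => simp [mulC]
  | succ c ih => simp [mulC, ih, Nat.succ_mul]

/-- The sum of `n` expressions. -/
def NExp.sum (f : ℕ → NExp) : ℕ → NExp
  | 0 => .const 0
  | n + 1 => .add (sum f n) (f n)

@[simp] theorem NExp.eval_sum (s : Config) (f : ℕ → NExp) (n : ℕ) :
    (sum f n).eval s = ∑ i ∈ Finset.range n, (f i).eval s := by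
  induction n with
  | zero => simp [sum]
  | succ n ih => simp [sum, ih, Finset.sum_range_succ]

/-- The value of a function on `{0, …, n - 1}`, looked up in a table. -/
def NExp.table (f : ℕ → ℕ) (n : ℕ) (e : NExp) : NExp :=
  .sum (fun i => .mulC (f i)
    (.sub (.const 1) (.add (.sub e (.const i)) (.sub (.const i) e)))) n

/-- With truncated subtraction, `1 - ((e - i) + (i - e))` is the indicator of `e = i`, so the sum
selects `f e` without multiplication of cells or branching. -/
theorem NExp.eval_table {s : Config} (f : ℕ → ℕ) {n : ℕ} {e : NExp} (h : e.eval s < n) :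
    (table f n e).eval s = f (e.eval s) := by
  simp only [table, eval_sum, eval_mulC, eval]
  rw [Finset.sum_eq_single (e.eval s)]
  · simp
  · intro i _ hi
    have : 1 - (e.eval s - i + (i - e.eval s)) = 0 := by omega
    rw [this, mul_zero]
  · simp [h]

/-- Equality of two expressions. -/
def Test.eqN (e f : NExp) : Test := .and (.leN e f) (.leN f e)

@[simp] theorem Test.holds_eqN {s : Config} {e f : NExp} :
    (eqN e f).Holds s ↔ e.eval s = f.eval s := by
  simp only [eqN, Holds]
  omega

/-- The conjunction of `n` tests. -/
def Test.all (f : ℕ → Test) : ℕ → Test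
  | 0 => .leN (.const 0) (.const 0)
  | n + 1 => .and (all f n) (f n)

@[simp] theorem Test.holds_all {s : Config} {f : ℕ → Test} {n : ℕ} :
    (all f n).Holds s ↔ ∀ i < n, (f i).Holds s := by
  induction n with
  | zero => simp [all]
  | succ n ih =>
    rw [all, Holds, ih]
    simp only [Nat.lt_succ_iff_lt_or_eq, or_imp, forall_and, forall_eq]

/-! ### Reading the advice -/

/-- The tape contains the string `l` at position `h`. -/
def TapeAt (tape : ℕ → Bool) (h : ℕ) (l : List Bool) : Prop :=
  ∀ i (hi : i < l.length), tape (h + i) = l[i]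

theorem tapeAt_append {h : ℕ} {l l' : List Bool} :
    TapeAt tape h (l ++ l') ↔ TapeAt tape h l ∧ TapeAt tape (h + l.length) l' := by
  constructor
  · intro H
    refine ⟨fun i hi => ?_, fun i hi => ?_⟩
    · rw [H i (by rw [List.length_append]; omega), List.getElem_append_left hi]
    · rw [add_assoc, H (l.length + i) (by rw [List.length_append]; omega),
        List.getElem_append_right (by omega)]
      simp
  · rintro ⟨H, H'⟩ i hi
    by_cases hl : i < l.length
    · rw [H i hl, List.getElem_append_left hl]
    · rw [List.length_append] at hi
      rw [List.getElem_append_right (by omega), ← H' (i - l.length) (by omega)]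
      congr 1
      omega

/-- Read a binary number with as many digits as cell `5` says into cell `d`. -/
def readNum (d : ℕ) : Prog :=
  .seq (.setN (.const d) (.const 0))
    (.loop (.leN (.const 1) (.at 5))
      (.seq (.readBit (.const 4))
        (.seq (.setN (.const d) (.add (.add (.at d) (.at d)) (.at 4)))
          (.setN (.const 5) (.sub (.at 5) (.const 1))))))

/-- The Horner step of `readNum`: while `j` digits are outstanding, the digits read so far form the
number `m >>> j`. -/
theorem shiftRight_eq_two_mul_add (m j : ℕ) :
    m >>> j = m >>> (j + 1) + m >>> (j + 1) + (m.testBit j).toNat := by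
  have h2 := Nat.div_add_mod (m >>> j) 2
  have h3 : m >>> (j + 1) = m >>> j / 2 := by rw [Nat.shiftRight_succ]
  rw [h3, Nat.toNat_testBit, ← Nat.shiftRight_eq_div_pow]
  omega

theorem tot_readNum {d m : ℕ} (hd4 : d ≠ 4) (hd5 : d ≠ 5) (hm : m < 2 ^ s.nat 5)
    (ht : TapeAt tape s.head (binary (s.nat 5) m)) :
    Tot tape (readNum d) s (1 + (s.nat 5 * 4 + 1)) fun s' =>
      s'.nat d = m ∧ s'.head = s.head + s.nat 5 ∧ s'.real = s.real ∧
      ∀ a, a ≠ d → a ≠ 4 → a ≠ 5 → s'.nat a = s.nat a := by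
  refine Tot.seq_self (Tot.setN ?_)
  refine Tot.loop (T := 3) (fun i s' => s'.nat 5 = s.nat 5 - i ∧ s'.nat d = m >>> (s.nat 5 - i) ∧
      s'.head = s.head + i ∧ s'.real = s.real ∧
      ∀ a, a ≠ d → a ≠ 4 → a ≠ 5 → s'.nat a = s.nat a) (s.nat 5) ?_ ?_ ?_ ?_
  · refine ⟨by simp [hd5.symm], ?_, rfl, rfl, ?_⟩
    · simp only [NExp.eval, Function.update_self, Nat.sub_zero]
      rw [Nat.shiftRight_eq_div_pow, Nat.div_eq_of_lt hm]
    · intro a ha _ _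
      simp [ha]
  · rintro i hi s' ⟨h1, h2, h3, h4, h5⟩
    refine ⟨by simp [h1]; omega, ?_⟩
    refine Tot.seq_self (Tot.readBit (Tot.seq_self (Tot.setN (Tot.setN ?_))))
    have hb : tape s'.head = m.testBit (s.nat 5 - (i + 1)) := by
      rw [h3, ht i (by simpa [binary] using hi)]
      simp only [binary, List.getElem_map, List.getElem_reverse, List.length_range,
        List.getElem_range]
      congr 1
      omega
    refine ⟨?_, ?_, ?_, h4, ?_⟩
    · simp [hd5.symm, h1]
      omega
    · have := shiftRight_eq_two_mul_add m (s.nat 5 - (i + 1))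
      rw [show s.nat 5 - (i + 1) + 1 = s.nat 5 - i by omega] at this
      simp [hd4, hd5, h2, hb, this]
    · simp only [h3]; omega
    · intro a h6 h7 h8
      simp [h6, h7, h8, h5 a h6 h7 h8]
  · rintro s' ⟨h1, -⟩
    simp [h1]
  · rintro s' ⟨-, h2, h3, h4, h5⟩
    exact ⟨by simpa using h2, h3, h4, h5⟩

/-- Read `m` binary numbers, each with as many digits as cell `7` says, into the cells
`d, d + 1, …`. -/
def readAll (d : ℕ) : ℕ → Prog
  | 0 => .skip
  | m + 1 => .seq (readAll d m) (.seq (.setN (.const 5) (.at 7)) (readNum (d + m)))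

theorem tot_readAll {d w : ℕ} (hd : 8 ≤ d) (hw : s.nat 7 = w) : ∀ vals : List ℕ,
    (∀ x ∈ vals, x < 2 ^ w) → TapeAt tape s.head (vals.flatMap (binary w)) →
    Tot tape (readAll d vals.length) s (1 + vals.length * (w * 4 + 3)) fun s' =>
      (∀ i (hi : i < vals.length), s'.nat (d + i) = vals[i]) ∧
      s'.head = s.head + vals.length * w ∧ s'.real = s.real ∧
      ∀ a, a ≠ 4 → a ≠ 5 → (a < d ∨ d + vals.length ≤ a) → s'.nat a = s.nat a := by
  intro vals
  induction vals using List.reverseRecOn with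
  | nil =>
    intro _ _
    refine Tot.mono (Tot.skip (Q := fun s' => s' = s) rfl) (by simp) ?_
    rintro _ rfl
    exact ⟨by simp, by simp, rfl, fun _ _ _ _ => rfl⟩
  | append_singleton vals x ih =>
    intro hv ht
    rw [List.flatMap_append, List.flatMap_singleton, tapeAt_append] at ht
    simp only [List.length_append, List.length_singleton]
    refine Tot.mono (Tot.seq (ih (fun y hy => hv y (by simp [hy])) ht.1)
      (T' := 1 + (1 + (w * 4 + 1))) ?_) (by linarith) fun _ h => h
    rintro s' ⟨h1, h2, h3, h4⟩
    have h7 : s'.nat 7 = w := by rw [h4 7 (by omega) (by omega) (by omega), hw]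
    refine Tot.seq_self (Tot.setN ?_)
    set s'' : Config :=
      { s' with nat := Function.update s'.nat ((NExp.const 5).eval s') ((NExp.at 7).eval s') }
      with hs''
    have h5 : s''.nat 5 = w := by simp [hs'', h7]
    have hlen : (vals.flatMap (binary w)).length = vals.length * w :=
      length_flatMap_binary w (fun x => x) vals
    have := tot_readNum (tape := tape) (s := s'') (d := d + vals.length) (m := x)
      (by omega) (by omega) (by rw [h5]; exact hv x (by simp)) (by
        rw [h5]
        change TapeAt tape s'.head _
        rw [h2, ← hlen]
        exact ht.2)
    rw [h5] at this
    refine Tot.mono this le_rfl ?_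
    rintro s₃ ⟨k1, k2, k3, k4⟩
    have k5 : ∀ a, a ≠ d + vals.length → a ≠ 4 → a ≠ 5 → s₃.nat a = s'.nat a := fun a a1 a2 a3 => by
      rw [k4 a a1 a2 a3]
      simp [hs'', a3]
    refine ⟨fun i hi => ?_, ?_, k3.trans h3, fun a a1 a2 a3 => ?_⟩
    · by_cases hi' : i < vals.length
      · rw [k5 _ (by omega) (by omega) (by omega), h1 i hi', List.getElem_append_left hi']
      · obtain rfl : i = vals.length := by simp at hi; omega
        rw [k1]
        simp
    · rw [k2]
      change s'.head + w = _
      rw [h2, Nat.add_mul]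
      omega
    · rw [k5 a (by omega) a1 a2, h4 a a1 a2 (by omega)]

/-- Read the length of the advice in its self-delimiting encoding into cell `6`. -/
def readLength : Prog :=
  .seq (.readBit (.const 4))
    (.seq (.loop (.leN (.const 1) (.at 4))
      (.seq (.setN (.const 5) (.add (.at 5) (.const 1))) (.readBit (.const 4))))
      (readNum 6))

theorem tot_readLength {m : ℕ} (h5 : s.nat 5 = 0)
    (ht : TapeAt tape s.head
      (List.replicate m.size true ++ [false] ++ binary m.size m)) :
    Tot tape readLength s (1 + ((m.size * 3 + 1) + (1 + (m.size * 4 + 1)))) fun s' =>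
      s'.nat 6 = m ∧ s'.head = s.head + (2 * m.size + 1) ∧ s'.real = s.real ∧
      ∀ a, a ≠ 4 → a ≠ 5 → a ≠ 6 → s'.nat a = s.nat a := by
  rw [tapeAt_append, tapeAt_append] at ht
  obtain ⟨⟨ht1, ht2⟩, ht3⟩ := ht
  refine Tot.seq_self (Tot.readBit (Tot.seq (R := fun s' => s'.nat 5 = m.size ∧
    s'.head = s.head + m.size + 1 ∧ s'.real = s.real ∧ ∀ a, a ≠ 4 → a ≠ 5 → s'.nat a = s.nat a)
    -- Reading is one bit ahead of counting: when `i` ones have been counted, `i + 1` bits have been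
    -- read and the cell `4` holds the bit at offset `i`. The loop ends at the separating zero.
    (Tot.loop (T := 2) (fun i s' => s'.nat 5 = i ∧ s'.nat 4 = (tape (s.head + i)).toNat ∧
      s'.head = s.head + i + 1 ∧ s'.real = s.real ∧
      ∀ a, a ≠ 4 → a ≠ 5 → s'.nat a = s.nat a) m.size ?_ ?_ ?_ ?_) ?_))
  · refine ⟨by simp [h5], by simp, rfl, rfl, fun a h4 h5 => by simp [h4]⟩
  · rintro i hi s' ⟨h1, h2, h3, h4, h5⟩
    have hb := ht1 i (by simpa using hi)
    rw [List.getElem_replicate] at hb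
    refine ⟨by simp [h2, hb], Tot.seq_self (Tot.setN (Tot.readBit ?_))⟩
    refine ⟨by simp [h1], by simp [h3, add_assoc], by simp [h3]; omega, h4, fun a h6 h7 => ?_⟩
    simp [h6, h7, h5 a h6 h7]
  · rintro s' ⟨-, h2, -⟩
    have hb := ht2 0 (by simp)
    simp only [List.length_replicate, add_zero, List.getElem_cons_zero] at hb
    simp [h2, hb]
  · rintro s' ⟨h1, -, h3⟩
    exact ⟨h1, h3⟩
  · rintro s' ⟨h1, h2, h3, h4⟩
    have := tot_readNum (tape := tape) (s := s') (d := 6) (m := m) (by omega) (by omega)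
      (by rw [h1]; exact Nat.lt_size_self m) (by
        rw [h1, h2]
        simpa [add_assoc] using ht3)
    rw [h1] at this
    refine Tot.mono this le_rfl ?_
    rintro s'' ⟨k1, k2, k3, k4⟩
    exact ⟨k1, by rw [k2, h2]; omega, k3.trans h3, fun a a4 a5 a6 => by
      rw [k4 a a6 a4 a5, h4 a a4 a5]⟩

/-- Divide the number in cell `6` by `K` and put the result into cell `7`. -/
def divide (K : ℕ) : Prog :=
  .loop (.leN (.const 1) (.at 6))
    (.seq (.setN (.const 6) (.sub (.at 6) (.const K)))
      (.setN (.const 7) (.add (.at 7) (.const 1))))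

/-- The common width of the numbers is not part of the advice. It is recovered from the length of
the string, which is k² times the width, by repeated subtraction. -/
theorem tot_divide {K w : ℕ} (hK : 0 < K) (h6 : s.nat 6 = K * w) (h7 : s.nat 7 = 0) :
    Tot tape (divide K) s (w * 3 + 1) fun s' =>
      s'.nat 7 = w ∧ s'.head = s.head ∧ s'.real = s.real ∧
      ∀ a, a ≠ 6 → a ≠ 7 → s'.nat a = s.nat a := by
  refine Tot.loop (T := 2) (fun i s' => s'.nat 6 = K * (w - i) ∧ s'.nat 7 = i ∧
      s'.head = s.head ∧ s'.real = s.real ∧ ∀ a, a ≠ 6 → a ≠ 7 → s'.nat a = s.nat a) w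
      ⟨by simpa using h6, h7, rfl, rfl, fun _ _ _ => rfl⟩ ?_ ?_ ?_
  · rintro i hi s' ⟨h1, h2, h3, h4, h5⟩
    have : K * (w - i) = K * (w - (i + 1)) + K := by
      rw [← Nat.mul_succ]
      congr 1
      omega
    refine ⟨by simp only [Test.Holds, NExp.eval, h1]; omega,
      Tot.seq_self (Tot.setN (Tot.setN ⟨?_, by simp [h2], h3, h4, fun a a6 a7 => ?_⟩))⟩
    · simp [h1, this]
    · simp [a6, a7, h5 a a6 a7]
  · rintro s' ⟨h1, -⟩
    simp [h1]
  · rintro s' ⟨-, h⟩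
    exact h

/-- Read the advice; the numbers `n_{i,j}` are put into the cells `d, d + 1, …`. -/
def readAdvice (k d : ℕ) : Prog :=
  .seq readLength (.seq (divide (k * k)) (readAll d (k * k)))

theorem tapeAt_of_startsWith {l : List Bool} (h : StartsWith tape l) : TapeAt tape 0 l :=
  fun i hi => by simpa using h ⟨i, hi⟩

theorem count_longBoxes_le (k : ℕ) (σ : List Vec) (b : Box) :
    (longBoxes k σ).count b ≤ σ.length := by
  refine (Multiset.count_le_card _ _).trans ?_
  rw [longBoxes, Multiset.coe_card, List.length_map]
  exact List.length_filter_le _ _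

theorem card_longBoxes_le (k : ℕ) (σ : List Vec) : (longBoxes k σ).card ≤ σ.length := by
  rw [longBoxes, Multiset.coe_card, List.length_map]
  exact List.length_filter_le _ _

/-- The last clause says which cells are still zero: the counter of open bins and the initial best
solution of the search rely on it. -/
theorem tot_readAdvice {k d : ℕ} (hk : 0 < k) (hd : 8 ≤ d) {σ : List Vec}
    (ht : StartsWith tape (advice k σ)) :
    Tot tape (readAdvice k d) ⟨fun _ => 0, fun _ => 0, 0⟩
      ((7 * (k * k) + 3 + k * k * 7) * σ.length + (5 + k * k * 7)) fun s' =>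
      (∀ q (hq : q < (allBoxes k).length),
        s'.nat (d + q) = (longBoxes k σ).count (allBoxes k)[q]) ∧
      s'.head = (advice k σ).length ∧ (∀ a, s'.real a = 0) ∧
      ∀ a, (a < 4 ∨ 8 ≤ a) → (a < d ∨ d + k * k ≤ a) → s'.nat a = 0 := by
  have hK := Nat.mul_pos hk hk
  set w := σ.length.size with hw
  have ht' := tapeAt_of_startsWith ht
  set vals := (allBoxes k).map fun b => (longBoxes k σ).count b with hvals
  have hvl : vals.length = k * k := by rw [hvals, List.length_map, length_allBoxes]
  have hfl : ((allBoxes k).flatMap fun b => binary w ((longBoxes k σ).count b)) =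
      vals.flatMap (binary w) := by rw [hvals, List.flatMap_map]
  have hlen : (vals.flatMap (binary w)).length = k * k * w := by
    rw [length_flatMap_binary w (fun x => x), hvl]
  rw [advice, selfDelimiting, ← hw, hfl, hlen, tapeAt_append] at ht'
  have hsz := size_le_self (k * k * w)
  have hwl : w ≤ σ.length := size_le_self _
  have hkw : k * k * w ≤ k * k * σ.length := Nat.mul_le_mul_left _ hwl
  refine Tot.mono (Tot.seq (tot_readLength rfl ht'.1) (T' := (w * 3 + 1) +
    (1 + k * k * (w * 4 + 3))) ?_) (by nlinarith) fun _ h => h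
  rintro s₁ ⟨h1, h2, h3, h4⟩
  refine Tot.seq (tot_divide hK h1 (h4 7 (by omega) (by omega) (by omega))) ?_
  rintro s₂ ⟨k1, k2, k3, k4⟩
  have := tot_readAll (tape := tape) hd k1 vals (by
    rw [hvals]
    simp only [List.mem_map]
    rintro _ ⟨b, -, rfl⟩
    exact (count_longBoxes_le k σ b).trans_lt (Nat.lt_size_self _)) (by
    rw [k2, h2]
    simpa [length_binary, two_mul, add_assoc, add_left_comm, add_comm] using ht'.2)
  simp only [hvl] at this
  refine Tot.mono this le_rfl ?_
  rintro s₃ ⟨l1, l2, l3, l4⟩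
  refine ⟨fun q hq => ?_, ?_, ?_, fun a a1 a2 => ?_⟩
  · rw [length_allBoxes] at hq
    rw [l1 q hq]
    simp [hvals]
  · rw [l2, k2, h2, length_advice, ← hw]
    simp
  · rw [l3, k3, h3]
    exact fun _ => rfl
  · rw [l4 a (by omega) (by omega) a2, k4 a (by omega) (by omega),
      h4 a (by omega) (by omega) (by omega)]

end programs

/-! ### Exhaustive search

The search runs through all numbers `c p` of bins of the types `p < T`. A bin of type `p` contains
`coef p q` vectors from the box number `q < K`. The numbers `c p` are stored in the cells
`cAddr p`, the best solution found so far in the cells `bAddr p`, and the numbers of vectors in the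
boxes in the cells `nAddr q`. -/

/-- The address of the current number of bins of type `p`. -/
abbrev cAddr (p : ℕ) : ℕ := 8 + p

/-- The address of the number of bins of type `p` in the best solution so far. -/
abbrev bAddr (T p : ℕ) : ℕ := 8 + T + p

/-- The address of the number of vectors in the box number `q`. -/
abbrev nAddr (T q : ℕ) : ℕ := 8 + 2 * T + q

/-- The bin numbers `x` pack exactly the given numbers of vectors. -/
def Solves (coef : ℕ → ℕ → ℕ) (T K : ℕ) (N x : ℕ → ℕ) : Prop :=
  ∀ q < K, ∑ p ∈ Finset.range T, coef p q * x p = N q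

/-- The total number of bins. -/
def total (T : ℕ) (x : ℕ → ℕ) : ℕ := ∑ p ∈ Finset.range T, x p

/-- `x` solves the packing problem if `y` does, and is then as good as `y`. -/
def Beats (coef : ℕ → ℕ → ℕ) (T K : ℕ) (N x y : ℕ → ℕ) : Prop :=
  Solves coef T K N y → Solves coef T K N x ∧ total T x ≤ total T y

theorem Beats.trans {coef : ℕ → ℕ → ℕ} {T K : ℕ} {N x y z : ℕ → ℕ} (h : Beats coef T K N x y)
    (h' : Beats coef T K N y z) : Beats coef T K N x z := fun hz =>
  ⟨(h (h' hz).1).1, (h (h' hz).1).2.trans (h' hz).2⟩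

open Classical in
/-- The better one of the current solution `c` and the best solution `b` so far. -/
def better (coef : ℕ → ℕ → ℕ) (T K : ℕ) (N c b : ℕ → ℕ) : ℕ → ℕ :=
  if Solves coef T K N c ∧ ¬ (Solves coef T K N b ∧ total T b ≤ total T c) then c else b

/-- The best solution after all values `c p ≤ B`, `p ∈ ps`, have been tried. -/
def searchResult (coef : ℕ → ℕ → ℕ) (T K B : ℕ) (N : ℕ → ℕ) :
    List ℕ → (ℕ → ℕ) → (ℕ → ℕ) → ℕ → ℕ
  | [], c, b => better coef T K N c b
  | p :: ps, c, b =>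
    (List.range (B + 1)).foldl
      (fun b i => searchResult coef T K B N ps (Function.update c p i) b) b

/-! ### Correctness of the search as a function -/

section correctness

variable {coef : ℕ → ℕ → ℕ} {T K B : ℕ} {N : ℕ → ℕ}

theorem solves_congr {x y : ℕ → ℕ} (h : ∀ p < T, x p = y p) :
    Solves coef T K N x ↔ Solves coef T K N y := by
  refine forall₂_congr fun q _ => ?_
  rw [Finset.sum_congr rfl fun p hp => by rw [h p (Finset.mem_range.1 hp)]]

theorem total_congr {x y : ℕ → ℕ} (h : ∀ p < T, x p = y p) : total T x = total T y :=
  Finset.sum_congr rfl fun p hp => h p (Finset.mem_range.1 hp)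

/-- The variables in `ps` are still free, the others are fixed by `c`. The result beats the incoming
best solution, so by transitivity whatever an earlier branch has beaten stays beaten. As `Beats`
demands nothing of a competitor that is no solution, the search can start from a vector that solves
nothing. -/
theorem searchResult_beats : ∀ (ps : List ℕ) (c b : ℕ → ℕ),
    Beats coef T K N (searchResult coef T K B N ps c b) b ∧
    ∀ x, (∀ p < T, x p ≤ B) → (∀ p < T, p ∉ ps → x p = c p) →
      Beats coef T K N (searchResult coef T K B N ps c b) x
  | [], c, b => by
    refine ⟨fun hb => ?_, fun x _ hx hs => ?_⟩
    · simp only [searchResult, better]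
      split_ifs with h
      · exact ⟨h.1, by by_contra hcon; exact h.2 ⟨hb, by omega⟩⟩
      · exact ⟨hb, le_rfl⟩
    · have hx' : ∀ p < T, x p = c p := fun p hp => hx p hp (by simp)
      rw [solves_congr hx'] at hs
      rw [total_congr hx']
      simp only [searchResult, better]
      split_ifs with h
      · exact ⟨hs, le_rfl⟩
      · by_contra hcon
        exact h ⟨hs, hcon⟩
  | p :: ps, c, b => by
    have key : ∀ (l : List ℕ) (b : ℕ → ℕ), Beats coef T K N (l.foldl
        (fun b i => searchResult coef T K B N ps (Function.update c p i) b) b) b ∧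
        ∀ i ∈ l, ∀ x, (∀ r < T, x r ≤ B) → (∀ r < T, r ∉ ps → x r = Function.update c p i r) →
          Beats coef T K N (l.foldl
            (fun b i => searchResult coef T K B N ps (Function.update c p i) b) b) x := by
      intro l
      induction l with
      | nil => exact fun b => ⟨fun h => ⟨h, le_rfl⟩, by simp⟩
      | cons j l ih =>
        intro b
        obtain ⟨h1, h2⟩ := ih (searchResult coef T K B N ps (Function.update c p j) b)
        obtain ⟨h3, h4⟩ := searchResult_beats ps (Function.update c p j) b
        refine ⟨h1.trans h3, fun i hi x hx hx' => ?_⟩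
        rcases List.mem_cons.1 hi with rfl | hi
        · exact h1.trans (h4 x hx hx')
        · exact h2 i hi x hx hx'
    refine ⟨(key _ b).1, fun x hx hx' => ?_⟩
    by_cases hp : p < T
    · refine (key _ b).2 (x p) (by simp [Nat.lt_succ_of_le (hx p hp)]) x hx fun r hr hr' => ?_
      by_cases hrp : r = p
      · simp [hrp]
      · rw [Function.update_of_ne hrp]
        exact hx' r hr (by simp [hrp, hr'])
    -- A variable `p ≥ T` influences neither the equations nor the total, so any value that is tried
    -- serves.
    · refine (key _ b).2 0 (by simp) x hx fun r hr hr' => ?_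
      have hrp : r ≠ p := by rintro rfl; exact hp hr
      rw [Function.update_of_ne hrp]
      exact hx' r hr (by simp [hrp, hr'])

end correctness

/-! ### The search as a program -/

/-- Do the numbers in the cells `A, A + 1, …` solve the packing problem? -/
def solvesTest (coef : ℕ → ℕ → ℕ) (T K A : ℕ) : Test :=
  .all (fun q => .eqN (.sum (fun p => .mulC (coef p q) (.at (A + p))) T) (.at (nAddr T q))) K

theorem holds_solvesTest {coef : ℕ → ℕ → ℕ} {T K A : ℕ} {s : Config} {N x : ℕ → ℕ}
    (hN : ∀ q < K, s.nat (nAddr T q) = N q) (hx : ∀ p < T, s.nat (A + p) = x p) :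
    (solvesTest coef T K A).Holds s ↔ Solves coef T K N x := by
  simp only [solvesTest, Test.holds_all, Test.holds_eqN, NExp.eval_sum, NExp.eval_mulC, NExp.eval]
  refine forall₂_congr fun q hq => ?_
  rw [hN q hq, Finset.sum_congr rfl fun p hp => by rw [hx p (Finset.mem_range.1 hp)]]

/-- Copy `n` cells from `A` to `D`. -/
def copy (A D : ℕ) : ℕ → Prog
  | 0 => .skip
  | n + 1 => .seq (copy A D n) (.setN (.const (D + n)) (.at (A + n)))

theorem tot_copy {tape : ℕ → Bool} {A D : ℕ} (s : Config) : ∀ n, A + n ≤ D →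
    Tot tape (copy A D n) s (n + 1) fun s' => (∀ i < n, s'.nat (D + i) = s.nat (A + i)) ∧
      s'.head = s.head ∧ s'.real = s.real ∧ ∀ a, (a < D ∨ D + n ≤ a) → s'.nat a = s.nat a
  | 0, _ => Tot.skip ⟨by simp, rfl, rfl, fun _ _ => rfl⟩
  | n + 1, h => by
    refine Tot.seq (tot_copy s n (by omega)) ?_
    rintro s' ⟨h1, h2, h3, h4⟩
    refine Tot.setN ⟨fun i hi => ?_, h2, h3, fun a ha => ?_⟩
    · by_cases hin : i = n
      · subst hin
        simp [h4 (A + i) (by omega)]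
      · simp only [NExp.eval, Function.update_apply, Nat.add_left_cancel_iff, if_neg hin]
        exact h1 i (by omega)
    · simp only [NExp.eval, Function.update_apply]
      rw [if_neg (by omega), h4 a (by omega)]

/-- Replace the best solution by the current one if the latter is better. -/
def updateBest (coef : ℕ → ℕ → ℕ) (T K : ℕ) : Prog :=
  .ite (.and (solvesTest coef T K 8) (.not (.and (solvesTest coef T K (8 + T))
      (.leN (.sum (fun p => .at (8 + T + p)) T) (.sum (fun p => .at (8 + p)) T)))))
    (copy 8 (8 + T) T) .skip

/-- The nested loops of the search. -/
def search (coef : ℕ → ℕ → ℕ) (T K : ℕ) : List ℕ → Prog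
  | [] => updateBest coef T K
  | p :: ps => .seq (.setN (.const (cAddr p)) (.const 0))
      (.loop (.leN (.at (cAddr p)) (.sum (fun q => .at (nAddr T q)) K))
        (.seq (search coef T K ps)
          (.setN (.const (cAddr p)) (.add (.at (cAddr p)) (.const 1)))))

/-- A bound on the running time of the search. -/
def searchTime (T n : ℕ) : List ℕ → ℕ
  | [] => T + 2
  | _ :: ps => 1 + ((n + 1) * (searchTime T n ps + 2) + 1)

/-- The configuration `s` contains the data of the search. -/
structure SearchState (T K : ℕ) (N : ℕ → ℕ) (ps : List ℕ) (c b : ℕ → ℕ) (s : Config) : Prop where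
  c_eq : ∀ p < T, p ∉ ps → s.nat (cAddr p) = c p
  b_eq : ∀ p < T, s.nat (bAddr T p) = b p
  n_eq : ∀ q < K, s.nat (nAddr T q) = N q

/-- The configurations differ at most in the working memory of the search. -/
structure SameOutside (T : ℕ) (s s' : Config) : Prop where
  head : s'.head = s.head
  real : s'.real = s.real
  nat : ∀ a, (a < 8 ∨ 8 + 2 * T ≤ a) → s'.nat a = s.nat a

theorem tot_updateBest {tape : ℕ → Bool} {coef : ℕ → ℕ → ℕ} {T K : ℕ} {N c b : ℕ → ℕ} {s : Config}
    (h : SearchState T K N [] c b s) : Tot tape (updateBest coef T K) s (T + 2) fun s' =>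
      SearchState T K N [] c (better coef T K N c b) s' ∧ SameOutside T s s' := by
  obtain ⟨h1, h2, h3⟩ := h
  have h1' : ∀ p < T, s.nat (8 + p) = c p := fun p hp => h1 p hp (by simp)
  have e : ∀ (A : ℕ) (x : ℕ → ℕ), (∀ p < T, s.nat (A + p) = x p) →
      (NExp.sum (fun p => .at (A + p)) T).eval s = total T x := fun A x hx => by
    simp only [NExp.eval_sum, NExp.eval]
    exact Finset.sum_congr rfl fun p hp => hx p (Finset.mem_range.1 hp)
  have hiff : (Test.and (solvesTest coef T K 8) (.not (.and (solvesTest coef T K (8 + T))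
      (.leN (.sum (fun p => .at (8 + T + p)) T) (.sum (fun p => .at (8 + p)) T))))).Holds s ↔
      Solves coef T K N c ∧ ¬ (Solves coef T K N b ∧ total T b ≤ total T c) := by
    simp only [Test.Holds, holds_solvesTest h3 h1', holds_solvesTest h3 h2]
    rw [e _ _ h1', e _ _ h2]
  refine Tot.mono (Tot.ite (T := T + 1) (fun hb => ?_) (fun hb => ?_)) (by omega) fun _ h => h
  · rw [hiff] at hb
    refine Tot.mono (tot_copy s T (by omega)) le_rfl ?_
    rintro s' ⟨k1, k2, k3, k4⟩
    rw [better, if_pos hb]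
    refine ⟨⟨fun p hp _ => ?_, fun p hp => ?_, fun q hq => ?_⟩, k2, k3, fun a ha => k4 a (by omega)⟩
    · rw [k4 _ (by unfold cAddr; omega), h1' p hp]
    · rw [k1 p hp, h1' p hp]
    · rw [k4 _ (by unfold nAddr; omega), h3 q hq]
  · rw [hiff] at hb
    rw [better, if_neg hb]
    exact Tot.mono (Tot.skip ⟨⟨h1, h2, h3⟩, rfl, rfl, fun _ _ => rfl⟩) (by omega) fun _ h => h

/-- The loops mirror the recursion of `searchResult`. `SearchState` says nothing about the cells of
the free variables, so an inner search may leave anything there; the counter of the outer loop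
survives because `p ∉ ps`. -/
theorem tot_search {tape : ℕ → Bool} {coef : ℕ → ℕ → ℕ} {T K n : ℕ} {N : ℕ → ℕ}
    (hn : ∑ q ∈ Finset.range K, N q ≤ n) : ∀ (ps : List ℕ), (∀ p ∈ ps, p < T) → ps.Nodup →
    ∀ (c b : ℕ → ℕ) (s : Config), SearchState T K N ps c b s →
    Tot tape (search coef T K ps) s (searchTime T n ps) fun s' =>
      SearchState T K N ps c
        (searchResult coef T K (∑ q ∈ Finset.range K, N q) N ps c b) s' ∧ SameOutside T s s'
  | [], _, _, c, b, s, h => tot_updateBest h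
  | p :: ps, hp, hnd, c, b, s, h => by
    set B := ∑ q ∈ Finset.range K, N q with hB
    have hpT := hp p (by simp)
    have hpps : p ∉ ps := (List.nodup_cons.1 hnd).1
    have hbound : ∀ s', (∀ q < K, s'.nat (nAddr T q) = N q) →
        (NExp.sum (fun q => .at (nAddr T q)) K).eval s' = B := fun s' hs' => by
      simp only [NExp.eval_sum, NExp.eval]
      exact Finset.sum_congr rfl fun q hq => hs' q (Finset.mem_range.1 hq)
    let best : ℕ → ℕ → ℕ := fun i => (List.range i).foldl
      (fun b i => searchResult coef T K B N ps (Function.update c p i) b) b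
    refine Tot.seq_self (Tot.setN (Tot.mono (Tot.loop (T := searchTime T n ps + 1)
      (fun i s' => s'.nat (cAddr p) = i ∧ SearchState T K N (p :: ps) c (best i) s' ∧
        SameOutside T s s') (B + 1) ?_ ?_ ?_ (fun _ h => h)) ?_ ?_))
    · obtain ⟨h1, h2, h3⟩ := h
      refine ⟨by simp, ⟨fun r hr hr' => ?_, fun r hr => ?_, fun q hq => ?_⟩, rfl, rfl, fun a ha => ?_⟩
      · have : r ≠ p := by rintro rfl; simp at hr'
        simpa [Function.update_apply, this] using h1 r hr hr'
      · simp only [NExp.eval, Function.update_apply, cAddr, bAddr]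
        rw [if_neg (by omega)]
        exact h2 r hr
      · simp only [NExp.eval, Function.update_apply, cAddr, nAddr]
        rw [if_neg (by omega), h3 q hq]
      · simp only [NExp.eval, Function.update_apply, cAddr]
        rw [if_neg (by omega)]
    · rintro i hi s' ⟨hi', ⟨h1, h2, h3⟩, h4, h5, h6⟩
      refine ⟨?_, ?_⟩
      · rw [Test.Holds, hbound s' h3]
        simp only [NExp.eval, hi']
        omega
      · refine Tot.seq (tot_search hn ps (fun r hr => hp r (by simp [hr])) (List.nodup_cons.1 hnd).2
          (Function.update c p i) (best i) s' ⟨fun r hr hr' => ?_, h2, h3⟩) ?_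
        · by_cases hrp : r = p
          · simp [hrp, hi']
          · rw [Function.update_of_ne hrp, h1 r hr (by simp [hrp, hr'])]
        · rintro s'' ⟨⟨k1, k2, k3⟩, k4, k5, k6⟩
          have hc := k1 p hpT hpps
          rw [Function.update_self] at hc
          have hb : best (i + 1) = searchResult coef T K B N ps (Function.update c p i) (best i) := by
            simp only [best, List.range_succ, List.foldl_append, List.foldl_cons, List.foldl_nil]
          refine Tot.setN ⟨by simp [hc], ⟨fun r hr hr' => ?_, fun r hr => ?_, fun q hq => ?_⟩,
            k4.trans h4, k5.trans h5, fun a ha => ?_⟩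
          · simp only [List.mem_cons, not_or] at hr'
            simp only [NExp.eval, Function.update_apply, cAddr]
            rw [if_neg (by omega), k1 r hr hr'.2, Function.update_of_ne hr'.1]
          · simp only [NExp.eval, Function.update_apply, cAddr, bAddr]
            rw [if_neg (by omega), hb]
            exact k2 r hr
          · simp only [NExp.eval, Function.update_apply, cAddr, nAddr]
            rw [if_neg (by omega), k3 q hq]
          · simp only [NExp.eval, Function.update_apply, cAddr]
            rw [if_neg (by omega), k6 a ha, h6 a ha]
    · rintro s' ⟨hi', ⟨h1, h2, h3⟩, -⟩
      rw [Test.Holds, hbound s' h3]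
      simp [hi']
    · have : (B + 1) * (searchTime T n ps + 1 + 1) ≤ (n + 1) * (searchTime T n ps + 2) :=
        Nat.mul_le_mul_right _ (by omega)
      omega
    · rintro s' ⟨-, h⟩
      exact h

/-- The bound on the running time of the search is a polynomial. -/
theorem exists_polynomial_searchTime (T : ℕ) : ∀ ps : List ℕ,
    ∃ P : Polynomial ℕ, ∀ n, searchTime T n ps = P.eval n
  | [] => ⟨Polynomial.C (T + 2), fun n => by simp [searchTime]⟩
  | _ :: ps => by
    obtain ⟨P, hP⟩ := exists_polynomial_searchTime T ps
    exact ⟨1 + ((Polynomial.X + 1) * (P + 2) + 1), fun n => by simp [searchTime, hP]⟩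

/-! ### The types of bins -/

open Classical in
/-- The possible contents of a bin of a packing of scaled vectors. -/
def patterns (k : ℕ) : List (Multiset Box) :=
  ((k • (allBoxes k : Multiset Box)).powerset.toFinset.filter
    fun t => ‖(t.map (scaled k)).sum‖ ≤ 1).toList

theorem mem_allBoxes {k : ℕ} {b : Box} :
    b ∈ allBoxes k ↔ (1 ≤ b.1 ∧ b.1 ≤ k) ∧ (1 ≤ b.2 ∧ b.2 ≤ k) := by
  obtain ⟨i, j⟩ := b
  change _ ∈ List.product _ _ ↔ _
  rw [List.pair_mem_product, List.mem_range'_1, List.mem_range'_1]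
  omega

theorem nodup_allBoxes (k : ℕ) : (allBoxes k).Nodup := by
  have h : (List.range' 1 k).Nodup := List.nodup_range'
  exact List.Nodup.product h h

theorem norm_sum_map_scaled_le_one_iff {k : ℕ} {t : Multiset Box} :
    ‖(t.map (scaled k)).sum‖ ≤ 1 ↔ (t.map (scaled k)).sum ≤ 1 :=
  norm_le_one_iff_of_nonneg (Multiset.sum_nonneg fun v hv => by
    obtain ⟨b, -, rfl⟩ := Multiset.mem_map.1 hv
    exact scaled_nonneg k b)

theorem card_le_of_norm_le_one {k : ℕ} (hk : 0 < k) {t : Multiset Box}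
    (ht : ∀ b ∈ t, b ∈ allBoxes k) (hn : ‖(t.map (scaled k)).sum‖ ≤ 1) : t.card ≤ k := by
  have hk' : (0 : ℝ) < k := by exact_mod_cast hk
  have h1 : (t.card : ℝ) * (1 / k) ≤ (t.map (scaled k)).sum.1 := by
    clear hn
    induction t using Multiset.induction with
    | empty => simp
    | cons b t ih =>
      have ih := ih fun c hc => ht c (by simp [hc])
      have hb : (1 : ℝ) ≤ b.1 := by exact_mod_cast (mem_allBoxes.1 (ht b (by simp))).1.1
      have : 1 / (k : ℝ) ≤ (scaled k b).1 := by
        simp only [scaled]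
        gcongr
      simp only [Multiset.map_cons, Multiset.sum_cons, Multiset.card_cons, Prod.fst_add]
      push_cast
      linarith
  have h2 := (norm_sum_map_scaled_le_one_iff.1 hn).1
  have h3 := h1.trans h2
  rw [mul_one_div, Prod.fst_one, div_le_one hk'] at h3
  exact_mod_cast h3

/-- The ambient multiset `k • allBoxes k` only serves finiteness. It excludes nothing, since scaled
vectors have first coordinate at least 1/k and a bin therefore holds at most k of them. -/
theorem mem_patterns {k : ℕ} (hk : 0 < k) {t : Multiset Box} :
    t ∈ patterns k ↔ (∀ b ∈ t, b ∈ allBoxes k) ∧ ‖(t.map (scaled k)).sum‖ ≤ 1 := by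
  classical
  simp only [patterns, Finset.mem_toList, Finset.mem_filter, Multiset.mem_toFinset,
    Multiset.mem_powerset]
  refine and_congr_left fun hn => ⟨fun h b hb => ?_, fun h => ?_⟩
  · have := Multiset.mem_of_le h hb
    rw [Multiset.mem_nsmul] at this
    simpa using this.2
  · rw [Multiset.le_iff_count]
    intro b
    rw [Multiset.count_nsmul]
    by_cases hb : b ∈ t
    · have h1 : 1 ≤ (allBoxes k : Multiset Box).count b :=
        Multiset.one_le_count_iff_mem.2 (by simpa using h b hb)
      have h2 := (Multiset.count_le_card b t).trans (card_le_of_norm_le_one hk h hn)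
      nlinarith
    · rw [Multiset.count_eq_zero_of_notMem hb]
      exact Nat.zero_le _

theorem nodup_patterns (k : ℕ) : (patterns k).Nodup := Finset.nodup_toList _

/-- Using up a reserved place leads again to a type, so the unused places of a bin can always be
stored as a single number. -/
theorem mem_patterns_of_le {k : ℕ} (hk : 0 < k) {t t' : Multiset Box} (ht : t ∈ patterns k)
    (h : t' ≤ t) : t' ∈ patterns k := by
  rw [mem_patterns hk, norm_sum_map_scaled_le_one_iff] at ht ⊢
  refine ⟨fun b hb => ht.1 b (Multiset.mem_of_le h hb), le_trans ?_ ht.2⟩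
  obtain ⟨u, rfl⟩ := Multiset.le_iff_exists_add.1 h
  rw [Multiset.map_add, Multiset.sum_add]
  exact le_add_of_nonneg_right (Multiset.sum_nonneg fun v hv => by
    obtain ⟨b, -, rfl⟩ := Multiset.mem_map.1 hv
    exact scaled_nonneg k b)

theorem zero_mem_patterns {k : ℕ} (hk : 0 < k) : 0 ∈ patterns k := by
  rw [mem_patterns hk]
  simp

/-- The number of types of bins. -/
abbrev numTypes (k : ℕ) : ℕ := (patterns k).length

/-- The boxes of the vectors in a bin of type `p`. -/
def typeBoxes (k p : ℕ) : Multiset Box := (patterns k).getD p 0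

/-- The box with the number `q`. -/
def nthBox (k q : ℕ) : Box := (allBoxes k).getD q (0, 0)

/-- The number of vectors from the box number `q` in a bin of type `p`. -/
def coef (k p q : ℕ) : ℕ := (typeBoxes k p).count (nthBox k q)

/-- The number of vectors from the box number `q`. -/
def boxCount (k : ℕ) (N : Multiset Box) (q : ℕ) : ℕ := N.count (nthBox k q)

theorem typeBoxes_mem {k p : ℕ} (hp : p < numTypes k) : typeBoxes k p ∈ patterns k := by
  rw [typeBoxes, List.getD_eq_getElem _ _ hp]
  exact List.getElem_mem _

open Classical in
/-- The type of the bins whose vectors come from the boxes in `t`. -/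
def typeOf (k : ℕ) (t : Multiset Box) : ℕ := (patterns k).idxOf t

theorem typeOf_lt {k : ℕ} {t : Multiset Box} (ht : t ∈ patterns k) : typeOf k t < numTypes k := by
  classical
  exact List.idxOf_lt_length_of_mem ht

theorem typeBoxes_typeOf {k : ℕ} {t : Multiset Box} (ht : t ∈ patterns k) :
    typeBoxes k (typeOf k t) = t := by
  classical
  rw [typeBoxes, List.getD_eq_getElem _ _ (typeOf_lt ht)]
  exact List.getElem_idxOf _

theorem exists_nthBox_eq {k : ℕ} {b : Box} (hb : b ∈ allBoxes k) :
    ∃ q < k * k, nthBox k q = b := by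
  obtain ⟨q, hq, rfl⟩ := List.getElem_of_mem hb
  exact ⟨q, by rwa [length_allBoxes] at hq, List.getD_eq_getElem _ _ hq⟩

theorem sum_range_getD {α : Type*} (d : α) (f : α → ℕ) (l : List α) :
    ∑ i ∈ Finset.range l.length, f (l.getD i d) = (l.map f).sum := by
  induction l with
  | nil => simp
  | cons a l ih =>
    rw [List.length_cons, Finset.sum_range_succ', List.map_cons, List.sum_cons, ← ih, add_comm]
    simp

/-- The packing with `x p` bins of type `p`. -/
def packingOf (k : ℕ) (x : ℕ → ℕ) (n : ℕ) : List (Multiset Box) :=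
  (List.range n).flatMap fun p => List.replicate (x p) (typeBoxes k p)

theorem packingOf_succ (k : ℕ) (x : ℕ → ℕ) (n : ℕ) : packingOf k x (n + 1) =
    packingOf k x n ++ List.replicate (x n) (typeBoxes k n) := by
  simp [packingOf, List.range_succ]

theorem length_packingOf (k : ℕ) (x : ℕ → ℕ) (n : ℕ) : (packingOf k x n).length = total n x := by
  induction n with
  | zero => simp [packingOf, total]
  | succ n ih => rw [packingOf_succ, List.length_append, ih, total, total, Finset.sum_range_succ,
      List.length_replicate]

theorem count_sum_packingOf (k : ℕ) (x : ℕ → ℕ) (b : Box) (n : ℕ) : (packingOf k x n).sum.count b =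
    ∑ p ∈ Finset.range n, (typeBoxes k p).count b * x p := by
  induction n with
  | zero => simp [packingOf]
  | succ n ih =>
    rw [packingOf_succ, List.sum_append, Multiset.count_add, ih, Finset.sum_range_succ,
      List.sum_replicate, Multiset.count_nsmul, mul_comm (x n)]

theorem mem_patterns_of_mem_packingOf {k : ℕ} {x : ℕ → ℕ} {t : Multiset Box}
    (ht : t ∈ packingOf k x (numTypes k)) : t ∈ patterns k := by
  simp only [packingOf, List.mem_flatMap, List.mem_range, List.mem_replicate] at ht
  obtain ⟨p, hp, -, rfl⟩ := ht
  exact typeBoxes_mem hp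

theorem sum_packingOf {k : ℕ} (hk : 0 < k) {N : Multiset Box} (hN : ∀ b ∈ N, b ∈ allBoxes k)
    {x : ℕ → ℕ} (hx : Solves (coef k) (numTypes k) (k * k) (boxCount k N) x) :
    (packingOf k x (numTypes k)).sum = N := by
  ext b
  by_cases hb : b ∈ allBoxes k
  · obtain ⟨q, hq, rfl⟩ := exists_nthBox_eq hb
    rw [count_sum_packingOf]
    exact hx q hq
  · rw [Multiset.count_eq_zero_of_notMem fun h => hb (hN b h), count_sum_packingOf]
    refine Finset.sum_eq_zero fun p hp => ?_
    have := ((mem_patterns hk).1 (typeBoxes_mem (Finset.mem_range.1 hp))).1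
    rw [Multiset.count_eq_zero_of_notMem fun h => hb (this b h), zero_mul]

open Classical in
-- A sum over the bins of `Q`, regrouped by type. With `f` the count of a box it shows that the
-- multiplicities in `Q` satisfy the packing equations; with `f = 1` it shows that their total is
-- the number of bins.
theorem sum_mul_count_typeBoxes {k : ℕ} (f : Multiset Box → ℕ) : ∀ {Q : List (Multiset Box)},
    (∀ t ∈ Q, t ∈ patterns k) →
    ∑ p ∈ Finset.range (numTypes k), f (typeBoxes k p) * Q.count (typeBoxes k p) = (Q.map f).sum
  | [], _ => by simp
  | t :: Q, h => by
    have h1 := sum_range_getD 0 (fun u => f u * if t = u then 1 else 0) (patterns k)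
    rw [← List.sum_toFinset _ (nodup_patterns k)] at h1
    simp only [mul_ite, mul_one, mul_zero, Finset.sum_ite_eq, List.mem_toFinset,
      h t List.mem_cons_self, if_true] at h1
    rw [List.map_cons, List.sum_cons,
      ← sum_mul_count_typeBoxes f fun u hu => h u (List.mem_cons_of_mem _ hu), ← h1,
      ← Finset.sum_add_distrib]
    refine Finset.sum_congr rfl fun p _ => ?_
    rw [List.count_cons, mul_add, add_comm]
    simp [typeBoxes]

theorem count_list_sum {α : Type*} [DecidableEq α] (a : α) (Q : List (Multiset α)) :
    Q.sum.count a = (Q.map (Multiset.count a)).sum := by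
  induction Q with
  | nil => simp
  | cons t Q ih => simp [ih]

theorem scaled_injective {k : ℕ} (hk : 0 < k) : Function.Injective (scaled k) := by
  rintro ⟨i, j⟩ ⟨i', j'⟩ h
  have hk' : (k : ℝ) ≠ 0 := by exact_mod_cast hk.ne'
  simp only [scaled, Prod.mk.injEq, div_left_inj' hk', Nat.cast_inj] at h
  exact Prod.ext h.1 h.2

theorem norm_scaled_le_one {k : ℕ} (hk : 0 < k) {b : Box} (hb : b ∈ allBoxes k) :
    ‖scaled k b‖ ≤ 1 := by
  have hk' : (0 : ℝ) < k := by exact_mod_cast hk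
  rw [norm_le_one_iff_of_nonneg (scaled_nonneg k b)]
  obtain ⟨⟨-, h1⟩, -, h2⟩ := mem_allBoxes.1 hb
  constructor
  · simp only [scaled, Prod.fst_one]
    rw [div_le_one hk']
    exact_mod_cast h1
  · simp only [scaled, Prod.snd_one]
    rw [div_le_one hk']
    exact_mod_cast h2

theorem norm_le_one_of_mem_map_scaled {k : ℕ} (hk : 0 < k) {N : Multiset Box}
    (hN : ∀ b ∈ N, b ∈ allBoxes k) : ∀ v ∈ N.map (scaled k), ‖v‖ ≤ 1 := by
  simp only [Multiset.mem_map]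
  rintro _ ⟨b, hb, rfl⟩
  exact norm_scaled_le_one hk (hN b hb)

/-- The optimum is defined through packings of vectors. Since `scaled` is injective, an optimal one
can be translated back to boxes. -/
theorem exists_optimal_patterns {k : ℕ} (hk : 0 < k) {N : Multiset Box}
    (hN : ∀ b ∈ N, b ∈ allBoxes k) : ∃ Q : List (Multiset Box), Q.sum = N ∧
      (∀ t ∈ Q, t ∈ patterns k) ∧ Q.length = opt (N.map (scaled k)) := by
  obtain ⟨P, ⟨hPs, hP⟩, hPl⟩ := exists_packing_length_eq_opt (norm_le_one_of_mem_map_scaled hk hN)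
  have hg := Function.leftInverse_invFun (scaled_injective hk)
  set g := Function.invFun (scaled k)
  have hsum : (P.map (Multiset.map g)).sum = N := by
    have : ∀ P : List (Multiset Vec), (P.map (Multiset.map g)).sum = P.sum.map g := fun P => by
      induction P with
      | nil => rfl
      | cons B P ih => simp [ih]
    rw [this, hPs, Multiset.map_map]
    simp [hg _]
  refine ⟨P.map (Multiset.map g), hsum, ?_, by rw [List.length_map, hPl]⟩
  intro t ht
  rw [mem_patterns hk]
  refine ⟨fun b hb => hN b (hsum ▸ mem_of_mem_list_sum ht hb), ?_⟩
  obtain ⟨B, hB, rfl⟩ := List.mem_map.1 ht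
  have : (B.map g).map (scaled k) = B := by
    rw [Multiset.map_map]
    conv_rhs => rw [← Multiset.map_id B]
    refine Multiset.map_congr rfl fun v hv => ?_
    have := mem_of_mem_list_sum hB hv
    rw [hPs] at this
    obtain ⟨b, -, rfl⟩ := Multiset.mem_map.1 this
    simp [hg b]
  rw [this]
  exact hP B hB

theorem card_eq_sum_boxCount {k : ℕ} {N : Multiset Box} (hN : ∀ b ∈ N, b ∈ allBoxes k) :
    ∑ q ∈ Finset.range (k * k), boxCount k N q = N.card := by
  rw [← length_allBoxes k]
  refine (sum_range_getD (0, 0) (fun b => N.count b) (allBoxes k)).trans ?_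
  rw [← List.sum_toFinset _ (nodup_allBoxes k), ← Multiset.toFinset_sum_count_eq N]
  refine (Finset.sum_subset (fun b hb => ?_) fun b _ hb => ?_).symm
  · simpa using hN b (by simpa using hb)
  · exact Multiset.count_eq_zero_of_notMem (by simpa using hb)

/-- The numbers of bins of the different types in the optimal packing that the search finds. -/
def packCounts (k : ℕ) (N : Multiset Box) : ℕ → ℕ :=
  searchResult (coef k) (numTypes k) (k * k) (∑ q ∈ Finset.range (k * k), boxCount k N q)
    (boxCount k N) (List.range (numTypes k)) (fun _ => 0) (fun _ => 0)

/-- The optimal packing that the search finds. -/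
def pack (k : ℕ) (N : Multiset Box) : List (Multiset Box) :=
  packingOf k (packCounts k N) (numTypes k)

theorem isOptimalBoxPacking_pack {k : ℕ} (hk : 0 < k) {N : Multiset Box}
    (hN : ∀ b ∈ N, b ∈ allBoxes k) : IsOptimalBoxPacking k (pack k N) N := by
  classical
  obtain ⟨Q, hQs, hQ, hQl⟩ := exists_optimal_patterns hk hN
  have hbeats := (searchResult_beats (coef := coef k) (T := numTypes k) (K := k * k)
    (B := ∑ q ∈ Finset.range (k * k), boxCount k N q) (N := boxCount k N)
    (List.range (numTypes k)) (fun _ => 0) (fun _ => 0)).2 (fun p => Q.count (typeBoxes k p))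
    -- The multiplicities of an optimal packing lie in the range of the search, because it has at
    -- most as many bins as there are vectors.
    (fun p _ => by
      rw [card_eq_sum_boxCount hN]
      refine List.count_le_length.trans (hQl.le.trans ?_)
      simpa using opt_le_card (norm_le_one_of_mem_map_scaled hk hN))
    (fun p hp hp' => absurd (List.mem_range.2 hp) hp')
  obtain ⟨h1, h2⟩ := hbeats fun q _ => by
    rw [boxCount, ← hQs, count_list_sum, ← sum_mul_count_typeBoxes _ hQ]
    rfl
  have h3 : total (numTypes k) (fun p => Q.count (typeBoxes k p)) = Q.length := by
    have := sum_mul_count_typeBoxes (fun _ => 1) hQ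
    simpa [total] using this
  have hsum := sum_packingOf hk hN h1
  have hpk : IsPacking ((pack k N).map (Multiset.map (scaled k))) (N.map (scaled k)) := by
    refine ⟨?_, ?_⟩
    · have : ∀ P : List (Multiset Box), (P.map (Multiset.map (scaled k))).sum =
          P.sum.map (scaled k) := fun P => by
        induction P with
        | nil => rfl
        | cons B P ih => simp [ih]
      rw [this, pack]
      exact congrArg _ hsum
    · simp only [List.mem_map]
      rintro _ ⟨t, ht, rfl⟩
      exact ((mem_patterns hk).1 (mem_patterns_of_mem_packingOf ht)).2
  refine ⟨hsum, hpk, le_antisymm ?_ ?_⟩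
  · rw [pack, length_packingOf, ← hQl, ← h3]
    exact h2
  · simpa using opt_le hpk

theorem longBoxes_subset {k : ℕ} (hk : 0 < k) {σ : List Vec}
    (hσ : ∀ v ∈ σ, v ∈ Set.Icc (0 : ℝ × ℝ) 1) : ∀ b ∈ longBoxes k σ, b ∈ allBoxes k := by
  have hk' : (0 : ℝ) < k := by exact_mod_cast hk
  have key : ∀ x : ℝ, x ≤ 1 → gridIndex k x ≤ k := fun x hx =>
    gridIndex_le hk hk (by rwa [div_self hk'.ne'])
  intro b hb
  simp only [longBoxes, Multiset.mem_coe, List.mem_map, List.mem_filter] at hb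
  obtain ⟨v, ⟨hv, -⟩, rfl⟩ := hb
  have := (hσ v hv).2
  exact mem_allBoxes.2 ⟨⟨gridIndex_pos _ _, key _ this.1⟩, gridIndex_pos _ _, key _ this.2⟩

section memory

/-! ### The open bins in the memory -/

/-- The configuration `s` contains the open bins: their number in the cell `1`, the types of their
reserved places in the cells `S, S + 1, …`, and their virtual loads in the real cells `4, 5, …`. -/
structure Represents (k S : ℕ) (bins : List Bin) (s : Config) : Prop where
  length : s.nat 1 = bins.length
  bin : ∀ i (h : i < bins.length), s.nat (S + i) < numTypes k ∧
    typeBoxes k (s.nat (S + i)) = bins[i].slots ∧ s.real (4 + i) = bins[i].vload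

variable {tape : ℕ → Bool} {k S : ℕ}

theorem Represents.append {bins : List Bin} {s s' : Config} (h : Represents k S bins s) {B : Bin}
    (h1 : s'.nat 1 = s.nat 1 + 1) (hn : ∀ i ≠ bins.length, s'.nat (S + i) = s.nat (S + i))
    (hr : ∀ i ≠ bins.length, s'.real (4 + i) = s.real (4 + i))
    (hlt : s'.nat (S + bins.length) < numTypes k)
    (hs : typeBoxes k (s'.nat (S + bins.length)) = B.slots)
    (hl : s'.real (4 + bins.length) = B.vload) : Represents k S (bins ++ [B]) s' where
  length := by rw [h1, h.length]; simp
  bin i hi := by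
    by_cases hi' : i < bins.length
    · rw [hn i (by omega), hr i (by omega), List.getElem_append_left hi']
      exact h.bin i hi'
    · obtain rfl : i = bins.length := by simp at hi; omega
      simpa using ⟨hlt, hs, hl⟩

theorem Represents.modify {bins : List Bin} {s s' : Config} (h : Represents k S bins s)
    {f : Bin → Bin} {i : ℕ} (hi : i < bins.length) (h1 : s'.nat 1 = s.nat 1)
    (hn : ∀ j ≠ i, s'.nat (S + j) = s.nat (S + j))
    (hr : ∀ j ≠ i, s'.real (4 + j) = s.real (4 + j))
    (hlt : s'.nat (S + i) < numTypes k)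
    (hs : typeBoxes k (s'.nat (S + i)) = (f bins[i]).slots)
    (hl : s'.real (4 + i) = (f bins[i]).vload) : Represents k S (bins.modify i f) s' where
  length := by rw [h1, h.length]; simp
  bin j hj := by
    rw [List.length_modify] at hj
    rw [List.getElem_modify]
    by_cases hij : i = j
    · subst hij
      simpa using ⟨hlt, hs, hl⟩
    · rw [if_neg hij, hn j (Ne.symm hij), hr j (Ne.symm hij)]
      exact h.bin j hj

/-! ### Opening the critical bins -/

/-- The virtual load of a new critical bin of type `p`. -/
def typeLoad (k p : ℕ) : ℚ := ((typeBoxes k p).map fun b => (b.1 : ℚ) / k + (b.2 : ℚ) / k).sum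

theorem typeLoad_eq (k p : ℕ) : (typeLoad k p : ℝ) = (criticalBin k (typeBoxes k p)).vload := by
  rw [typeLoad, criticalBin]
  change (Rat.castHom ℝ) _ = _
  rw [map_multiset_sum, Multiset.map_map]
  refine congrArg _ (Multiset.map_congr rfl fun b _ => ?_)
  rw [l1_of_nonneg (scaled_nonneg k b)]
  simp [scaled]

/-- Open the critical bins of the types less than the last argument. -/
def openBins (k S T : ℕ) : ℕ → Prog
  | 0 => .skip
  | p + 1 => .seq (openBins k S T p)
      (.loop (.leN (.const 1) (.at (bAddr T p)))
        (.seq (.setN (.add (.const S) (.at 1)) (.const p))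
          (.seq (.setR (.add (.const 4) (.at 1)) (.const (typeLoad k p)))
            (.seq (.setN (.const 1) (.add (.at 1) (.const 1)))
              (.setN (.const (bAddr T p)) (.sub (.at (bAddr T p)) (.const 1)))))))

theorem criticalBins_append (k : ℕ) (P P' : List (Multiset Box)) :
    criticalBins k (P ++ P') = criticalBins k P ++ criticalBins k P' := by simp [criticalBins]

/-- The multiplicities found by the search are counted down, at five steps per bin. The bins appear
in the order of `packingOf`, which matters because the strategy takes the first bin that fits. -/
theorem tot_openBins {T : ℕ} (hS : 8 + 2 * T ≤ S) (hT : T ≤ numTypes k) {s : Config} {b : ℕ → ℕ}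
    (h1 : s.nat 1 = 0) (hb : ∀ p < T, s.nat (bAddr T p) = b p) : ∀ n ≤ T,
    Tot tape (openBins k S T n) s (1 + n + 5 * total n b) fun s' =>
      Represents k S (criticalBins k (packingOf k b n)) s' ∧ s'.head = s.head ∧
      ∀ p < T, n ≤ p → s'.nat (bAddr T p) = b p
  | 0, _ => Tot.mono (Tot.skip
      ⟨⟨by simpa [criticalBins, packingOf] using h1, by simp [criticalBins, packingOf]⟩, rfl,
        fun p hp _ => hb p hp⟩) (by simp) fun _ h => h
  | n + 1, hn => by
    refine Tot.mono (Tot.seq (tot_openBins hS hT h1 hb n (by omega)) (T' := b n * (4 + 1) + 1)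
      fun s₀ hs₀ => ?_) ?_ fun _ h => h
    · refine Tot.loop (fun i s' => s'.nat (bAddr T n) = b n - i ∧
        Represents k S (criticalBins k (packingOf k b n ++ List.replicate i (typeBoxes k n))) s' ∧
        s'.head = s.head ∧ ∀ p < T, n + 1 ≤ p → s'.nat (bAddr T p) = b p) (b n)
        ⟨?_, ?_, hs₀.2.1, fun p hp hp' => hs₀.2.2 p hp (by omega)⟩ ?_ ?_ ?_
      · exact hs₀.2.2 n (by omega) le_rfl
      · simpa using hs₀.1
      · rintro i hi s' ⟨k1, k2, k3, k4⟩
        refine ⟨by simp only [Test.Holds, NExp.eval, k1]; omega, ?_⟩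
        refine Tot.seq_self (Tot.setN (Tot.seq_self (Tot.setR (Tot.seq_self (Tot.setN
          (Tot.setN ⟨?_, ?_, k3, fun p hp hp' => ?_⟩))))))
        · simp only [NExp.eval, Function.update_apply, bAddr] at k1 ⊢
          rw [if_true, if_neg (by omega), if_neg (by omega), k1]
          omega
        · rw [List.replicate_succ', ← List.append_assoc, criticalBins_append]
          set bins := criticalBins k (packingOf k b n ++ List.replicate i (typeBoxes k n))
          have hlen := k2.length
          refine k2.append (B := criticalBin k (typeBoxes k n)) ?_ (fun j hj => ?_) (fun j hj => ?_)
            ?_ ?_ ?_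
          · simp only [NExp.eval, Function.update_apply, bAddr]
            rw [if_neg (by omega), if_true, if_neg (by omega)]
          · simp only [NExp.eval, Function.update_apply, bAddr]
            rw [if_neg (by omega), if_neg (by omega), if_neg (by omega)]
          · simp only [NExp.eval, Function.update_apply]
            rw [if_neg (by rw [if_neg (by omega)]; omega)]
          · simp only [NExp.eval, Function.update_apply, bAddr]
            rw [if_neg (by omega), if_neg (by omega), if_pos (by omega)]
            omega
          · simp only [NExp.eval, Function.update_apply, bAddr]
            rw [if_neg (by omega), if_neg (by omega), if_pos (by omega)]
            rfl
          · simp only [NExp.eval, RExp.eval, Function.update_apply]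
            rw [if_pos (by rw [if_neg (by omega), hlen]), typeLoad_eq]
        · have := k4 p hp hp'
          simp only [NExp.eval, Function.update_apply, bAddr] at this ⊢
          rw [if_neg (by omega), if_neg (by omega), if_neg (by omega), this]
      · rintro s' ⟨k1, -⟩
        simp [k1]
      · rintro s' ⟨-, k2, k3, k4⟩
        rw [packingOf_succ]
        exact ⟨k2, k3, k4⟩
    · have : total (n + 1) b = total n b + b n := Finset.sum_range_succ _ _
      omega

/-! ### Serving a request -/

/-- The content of a real cell with a fixed address. -/
abbrev RExp.at (a : ℕ) : RExp := .cell (.const a)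

/-- Find the first of `m` bins that passes the test `acc`, where `m` is in the cell `1`. The index
of the bin is in the cell `0`. -/
def find (acc : Test) : Prog :=
  .seq (.setN (.const 0) (.const 0))
    (.loop (.and (.leN (.add (.at 0) (.const 1)) (.at 1)) (.not acc))
      (.setN (.const 0) (.add (.at 0) (.const 1))))

/-- The test reads the bin number from the cell `0`, so the loop counter is itself the answer. If no
bin passes, it stops at the number of open bins, in agreement with `choice`. -/
theorem tot_find {acc : Test} {bins : List Bin} {f : Bin → Bool} {s : Config}
    (hlen : s.nat 1 = bins.length) (hacc : ∀ i (h : i < bins.length),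
      acc.Holds { s with nat := Function.update s.nat 0 i } ↔ f bins[i] = true) :
    Tot tape (find acc) s (2 * bins.length + 2) fun s' =>
      s' = { s with nat := Function.update s.nat 0 (bins.findIdx f) } := by
  refine Tot.mono (Tot.seq_self (Tot.setN (Tot.loop (T := 1)
    (fun i s' => s' = { s with nat := Function.update s.nat 0 i }) (bins.findIdx f) rfl ?_ ?_
    fun _ h => h))) ?_ fun _ h => h
  · rintro i hi _ rfl
    have hi' : i < bins.length := hi.trans_le List.findIdx_le_length
    refine ⟨?_, Tot.setN ?_⟩
    · rw [Test.Holds, Test.Holds, Test.Holds, hacc i hi']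
      refine ⟨?_, ?_⟩
      · simp [hlen]
        omega
      · have := List.not_of_lt_findIdx hi
        simpa using this
    · simp
  · rintro _ rfl ⟨h1, h2⟩
    have h3 : bins.findIdx f < bins.length := by
      simp [hlen] at h1
      simpa using h1
    rw [Test.Holds, hacc _ h3] at h2
    exact h2 (List.findIdx_getElem (w := h3))
  · have : bins.findIdx f ≤ bins.length := List.findIdx_le_length
    omega

/-- Put the grid index of the number in the real cell `a` into the cell `g`, and the corresponding
multiple of `1/k` into the real cell `r`. The last argument is the number of tests. -/
def findGridIndex (k a g r : ℕ) : ℕ → Prog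
  | 0 => .seq (.setN (.const g) (.const 1)) (.setR (.const r) (.const (1 / k)))
  | n + 1 => .seq (findGridIndex k a g r n)
      (.ite (.leR (.at a) (.const ((n + 1 : ℕ) / k))) .skip
        (.seq (.setN (.const g) (.add (.at g) (.const 1)))
          (.setR (.const r) (.add (.at r) (.const (1 / k))))))

/-- In place of rounding, the number is compared with 1/k, …, n/k, and the matching multiple of 1/k
is accumulated alongside. The index is thus capped at `n + 1`, so `n = k - 1` comparisons suffice
for numbers up to 1. -/
theorem tot_findGridIndex (hk : 0 < k) {a g r : ℕ} (har : a ≠ r) (s : Config) : ∀ n,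
    Tot tape (findGridIndex k a g r n) s (2 + 3 * n) fun s' =>
      s' = { s with
        nat := Function.update s.nat g (min (gridIndex k (s.real a)) (n + 1)),
        real := Function.update s.real r
          ((min (gridIndex k (s.real a)) (n + 1) : ℕ) / (k : ℝ)) }
  | 0 => by
    refine Tot.mono (Tot.seq_self (Tot.setN (Tot.setR ?_))) (by omega) fun _ h => h
    have : min (gridIndex k (s.real a)) (0 + 1) = 1 := min_eq_right (gridIndex_pos _ _)
    simp [this]
  | n + 1 => by
    refine Tot.mono (Tot.seq (tot_findGridIndex hk har s n) (T' := 1 + 2) ?_) (by omega)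
      fun _ h => h
    rintro _ rfl
    set x := s.real a with hx
    have hk' : (0 : ℝ) < k := by exact_mod_cast hk
    refine Tot.ite (fun hb => ?_) (fun hb => ?_)
    · refine Tot.mono (Tot.skip ?_) (by omega) fun _ h => h
      have h1 : x ≤ ((n + 1 : ℕ) : ℝ) / k := by simpa [har, ← hx] using hb
      have h2 := gridIndex_le hk (by omega) h1
      rw [min_eq_left h2, min_eq_left (h2.trans (Nat.le_succ _))]
    · have h1 : ((n + 1 : ℕ) : ℝ) / k < x := by simpa [har, ← hx] using hb
      have h2 : n + 1 < gridIndex k x := by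
        have := h1.trans_le (le_gridIndex_div hk x)
        rw [div_lt_div_iff_of_pos_right hk'] at this
        exact_mod_cast this
      refine Tot.seq_self (Tot.setN (Tot.setR ?_))
      rw [min_eq_right h2.le, min_eq_right h2]
      simp [add_div]

/-- The bin number in the cell `0` is the number of an open bin. -/
def foundTest : Test := .leN (.add (.at 0) (.const 1)) (.at 1)

/-- The `L₁`-norm of the request. -/
def requestNorm : RExp := .add (.at 0) (.at 1)

/-- The virtual load of the bin whose number is in the cell `0`. -/
def binLoad : RExp := .cell (.add (.const 4) (.at 0))

/-- The type of the reserved places in the bin whose number is in the cell `0`. -/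
def binType (S : ℕ) : NExp := .cell (.add (.const S) (.at 0))

/-- Put the request into a new bin. -/
def openBin (k S : ℕ) : Prog :=
  .seq (.setN (.add (.const S) (.at 1)) (.const (typeOf k 0)))
    (.seq (.setR (.add (.const 4) (.at 1)) requestNorm)
      (.setN (.const 1) (.add (.at 1) (.const 1))))

/-- A type together with a box, encoded as a number. -/
def pairCode (k t : ℕ) (b : Box) : ℕ := (k + 1) * ((k + 1) * t + b.1) + b.2

/-- The type encoded in a number. -/
def codeType (k c : ℕ) : ℕ := c / (k + 1) / (k + 1)

/-- The box encoded in a number. -/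
def codeBox (k c : ℕ) : Box := (c / (k + 1) % (k + 1), c % (k + 1))

/-- Box indices go up to k, so they are digits in base `k + 1`. -/
theorem codeType_pairCode {t : ℕ} {b : Box} (h1 : b.1 ≤ k) (h2 : b.2 ≤ k) :
    codeType k (pairCode k t b) = t := by
  rw [codeType, pairCode, Nat.mul_add_div (by omega), Nat.div_eq_of_lt (a := b.2) (by omega),
    add_zero, Nat.mul_add_div (by omega), Nat.div_eq_of_lt (a := b.1) (by omega), add_zero]

theorem codeBox_pairCode {t : ℕ} {b : Box} (h1 : b.1 ≤ k) (h2 : b.2 ≤ k) :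
    codeBox k (pairCode k t b) = b := by
  rw [codeBox, pairCode, Nat.mul_add_div (by omega), Nat.div_eq_of_lt (a := b.2) (by omega),
    add_zero, Nat.mul_add_mod, Nat.mul_add_mod, Nat.mod_eq_of_lt (by omega),
    Nat.mod_eq_of_lt (by omega)]

theorem pairCode_lt {t T : ℕ} {b : Box} (h1 : b.1 ≤ k) (h2 : b.2 ≤ k) (ht : t < T) :
    pairCode k t b < (k + 1) * ((k + 1) * T) := by
  have h3 : (k + 1) * t + b.1 + 1 ≤ (k + 1) * T := by
    calc _ ≤ (k + 1) * (t + 1) := by rw [Nat.mul_succ]; omega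
      _ ≤ _ := Nat.mul_le_mul_left _ ht
  calc pairCode k t b < (k + 1) * ((k + 1) * t + b.1 + 1) := by
        rw [pairCode, Nat.mul_succ]; omega
    _ ≤ _ := Nat.mul_le_mul_left _ h3

/-- The code of the bin type in question and of the box in the cells `2` and `3`. -/
def pairExp (k S : ℕ) : NExp :=
  .add (.mulC (k + 1) (.add (.mulC (k + 1) (binType S)) (.at 2))) (.at 3)

/-- The value of a function of the bin type in question and of the box in the cells `2` and `3`. -/
def pairTable (k S : ℕ) (f : ℕ → Box → ℕ) : NExp :=
  .table (fun c => f (codeType k c) (codeBox k c)) ((k + 1) * ((k + 1) * numTypes k)) (pairExp k S)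

theorem eval_pairTable {s : Config} {f : ℕ → Box → ℕ} (ht : s.nat (S + s.nat 0) < numTypes k)
    (h2 : s.nat 2 ≤ k) (h3 : s.nat 3 ≤ k) :
    (pairTable k S f).eval s = f (s.nat (S + s.nat 0)) (s.nat 2, s.nat 3) := by
  have e : (pairExp k S).eval s = pairCode k (s.nat (S + s.nat 0)) (s.nat 2, s.nat 3) := by
    simp [pairExp, binType, pairCode]
  rw [pairTable, NExp.eval_table _ (by rw [e]; exact pairCode_lt h2 h3 ht), e,
    codeType_pairCode h2 h3, codeBox_pairCode h2 h3]

open Classical in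
/-- The test whether a place for the request is reserved in the bin in question. -/
def reservedTest (k S : ℕ) : Test :=
  .leN (.const 1) (pairTable k S fun t b => if b ∈ typeBoxes k t then 1 else 0)

/-- The test whether a short request fits into the bin in question. -/
def shortFitsTest : Test := .leR (.add binLoad requestNorm) (.const 1)

/-- Serve a short request. -/
def serveShort (k S : ℕ) : Prog :=
  .seq (find shortFitsTest)
    (.ite foundTest (.setR (.add (.const 4) (.at 0)) (.add binLoad requestNorm)) (openBin k S))

/-- Serve a long request. -/
def serveLong (k S : ℕ) : Prog :=
  .seq (findGridIndex k 0 2 2 (k - 1)) (.seq (findGridIndex k 1 3 3 (k - 1))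
    (.seq (find (reservedTest k S))
      (.ite foundTest
        (.seq (.setN (.add (.const S) (.at 0))
            (pairTable k S fun t b => typeOf k ((typeBoxes k t).erase b)))
          (.setR (.add (.const 4) (.at 0))
            (.sub binLoad (.sub (.add (.at 2) (.at 3)) requestNorm))))
        (openBin k S))))

/-- Serve a request. -/
def serveProg (k S : ℕ) : Prog :=
  .ite (.and (.leR (.at 0) (.const (40 / k))) (.leR (.at 1) (.const (40 / k))))
    (serveShort k S) (serveLong k S)

theorem tot_openBin (hk : 0 < k) (hS : 8 ≤ S) {bins : List Bin} {s : Config} {v : Vec}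
    (hv : 0 ≤ v) (h : Represents k S bins s) (hr : (s.real 0, s.real 1) = v)
    (h0 : s.nat 0 = choice k bins v) (hc : ¬ choice k bins v < bins.length) :
    Tot tape (openBin k S) s 3 fun s' =>
      Represents k S (serve k bins v) s' ∧ s'.nat 0 = choice k bins v ∧ s'.head = s.head := by
  have hlen := h.length
  have h0t := zero_mem_patterns hk
  subst hr
  refine Tot.seq_self (Tot.setN (Tot.seq_self (Tot.setR (Tot.setN ⟨?_, ?_, rfl⟩))))
  · rw [serve, if_neg hc]
    refine h.append (B := newBin _) ?_ (fun j hj => ?_) (fun j hj => ?_) ?_ ?_ ?_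
    · simp only [NExp.eval, Function.update_apply]
      rw [if_true, if_neg (by omega)]
    · simp only [NExp.eval, Function.update_apply]
      rw [if_neg (by omega), if_neg (by omega)]
    · simp only [NExp.eval, Function.update_apply]
      rw [if_neg (by rw [if_neg (by omega)]; omega)]
    · simp only [NExp.eval, Function.update_apply]
      rw [if_neg (by omega), if_pos (by omega)]
      exact typeOf_lt h0t
    · simp only [NExp.eval, Function.update_apply]
      rw [if_neg (by omega), if_pos (by omega)]
      exact typeBoxes_typeOf h0t
    · simp only [NExp.eval, RExp.eval, requestNorm, Function.update_apply]
      rw [if_pos (by rw [if_neg (by omega), hlen]), newBin, l1_of_nonneg hv]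
  · simp only [NExp.eval, Function.update_apply]
    rw [if_neg (by omega), if_neg (by omega), h0]

theorem tot_serveShort (hk : 0 < k) (hS : 8 ≤ S) {bins : List Bin} {s : Config} {v : Vec}
    (hv : 0 ≤ v) (hs : IsShort k v) (h : Represents k S bins s)
    (hr : (s.real 0, s.real 1) = v) :
    Tot tape (serveShort k S) s (2 * bins.length + 2 + (1 + 3)) fun s' =>
      Represents k S (serve k bins v) s' ∧ s'.nat 0 = choice k bins v ∧ s'.head = s.head := by
  have hlen := h.length
  have hl : l1 v = s.real 0 + s.real 1 := by rw [l1_of_nonneg hv, ← hr]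
  refine Tot.seq (tot_find (f := accepts k v) hlen fun i hi => ?_) ?_
  · rw [accepts, if_pos hs, decide_eq_true_iff, hl, ← (h.bin i hi).2.2]
    simp [shortFitsTest, binLoad, requestNorm]
  · change ∀ s', s' = { s with nat := Function.update s.nat 0 (choice k bins v) } → _
    rintro _ rfl
    have hrep : Represents k S bins { s with nat := Function.update s.nat 0 (choice k bins v) } :=
      ⟨by simpa using hlen, fun i hi => by
        simpa only [Function.update_of_ne (show S + i ≠ 0 by omega)] using h.bin i hi⟩
    refine Tot.ite (fun hb => ?_) fun hb => ?_
    · have hc : choice k bins v < bins.length := by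
        simp [foundTest, hlen] at hb
        omega
      refine Tot.mono (Tot.setR ⟨?_, by simp, rfl⟩) (by omega) fun _ h => h
      rw [serve, if_pos hc]
      have hb := hrep.bin _ hc
      refine hrep.modify hc rfl (fun _ _ => rfl) (fun j hj => ?_) hb.1 ?_ ?_
      · simp [hj]
      · rw [addTo, if_pos hs]
        exact hb.2.1
      · rw [addTo, if_pos hs, ← hb.2.2, hl]
        simp [binLoad, requestNorm]
    · have hc : ¬ choice k bins v < bins.length := by
        simp [foundTest, hlen] at hb
        omega
      exact tot_openBin hk hS hv hrep hr (by simp) hc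

/-- Membership of the box in the slots and the type after erasing it are table lookups. The
simulation holds for any represented bins; that a long vector always finds a place is not needed
here. -/
theorem tot_serveLong (hk : 0 < k) (hS : 8 ≤ S) {bins : List Bin} {s : Config} {v : Vec}
    (hv : v ∈ Set.Icc (0 : ℝ × ℝ) 1) (hs : ¬ IsShort k v) (h : Represents k S bins s)
    (hr : (s.real 0, s.real 1) = v) :
    Tot tape (serveLong k S) s
      (2 + 3 * (k - 1) + (2 + 3 * (k - 1) + (2 * bins.length + 2 + (1 + 3)))) fun s' =>
      Represents k S (serve k bins v) s' ∧ s'.nat 0 = choice k bins v ∧ s'.head = s.head := by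
  have hk' : (0 : ℝ) < k := by exact_mod_cast hk
  have hgrid : ∀ x : ℝ, x ≤ 1 → gridIndex k x ≤ k := fun x hx =>
    gridIndex_le hk hk (by rwa [div_self hk'.ne'])
  have hv1 := hv.2.1
  have hv2 := hv.2.2
  have hr1 : s.real 0 = v.1 := by rw [← hr]
  have hr2 : s.real 1 = v.2 := by rw [← hr]
  refine Tot.seq (tot_findGridIndex hk (by omega) s (k - 1)) ?_
  rintro _ rfl
  refine Tot.seq (tot_findGridIndex hk (by omega) _ (k - 1)) ?_
  rintro _ rfl
  simp only [Function.update_of_ne (show (1 : ℕ) ≠ 2 by omega), hr1, hr2, Nat.sub_add_cancel hk,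
    min_eq_left (hgrid _ hv1), min_eq_left (hgrid _ hv2)]
  set s₁ : Config := { s with
    nat := Function.update (Function.update s.nat 2 (gridIndex k v.1)) 3 (gridIndex k v.2)
    real := Function.update (Function.update s.real 2 ((gridIndex k v.1 : ℝ) / k)) 3
      ((gridIndex k v.2 : ℝ) / k) } with hs₁
  have h₁ : Represents k S bins s₁ := ⟨by simpa [hs₁] using h.length, fun i hi => by
    have := h.bin i hi
    simpa [hs₁, Function.update_apply, show S + i ≠ 2 by omega, show S + i ≠ 3 by omega,
      show 4 + i ≠ 2 by omega, show 4 + i ≠ 3 by omega] using this⟩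
  have hn2 : s₁.nat 2 = gridIndex k v.1 := by simp [hs₁]
  have hn3 : s₁.nat 3 = gridIndex k v.2 := by simp [hs₁]
  have hR2 : s₁.real 2 = (gridIndex k v.1 : ℝ) / k := by simp [hs₁]
  have hR3 : s₁.real 3 = (gridIndex k v.2 : ℝ) / k := by simp [hs₁]
  have hR : (s₁.real 0, s₁.real 1) = v := by rw [← hr]; simp [hs₁]
  have hhead : s₁.head = s.head := rfl
  rw [← hhead]
  clear_value s₁
  have hlen := h₁.length
  have hl : l1 v = s₁.real 0 + s₁.real 1 := by rw [l1_of_nonneg hv.1, ← hR]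
  have htab : ∀ (f : ℕ → Box → ℕ) (i : ℕ), i < bins.length →
      (pairTable k S f).eval { s₁ with nat := Function.update s₁.nat 0 i } =
      f (s₁.nat (S + i)) (boxOf k v) := by
    intro f i hi
    have hb := h₁.bin i hi
    have hne : S + i ≠ 0 := by omega
    rw [eval_pairTable]
    · simp only [Function.update_self, Function.update_of_ne hne,
        Function.update_of_ne (show (2 : ℕ) ≠ 0 by omega),
        Function.update_of_ne (show (3 : ℕ) ≠ 0 by omega), hn2, hn3]
      rfl
    · simpa only [Function.update_of_ne hne, Function.update_self] using hb.1
    · simpa [hn2] using hgrid _ hv1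
    · simpa [hn3] using hgrid _ hv2
  refine Tot.seq (tot_find (f := accepts k v) hlen fun i hi => ?_) ?_
  · rw [accepts, if_neg hs, decide_eq_true_iff, ← (h₁.bin i hi).2.1, reservedTest, Test.Holds,
      htab _ i hi]
    split_ifs with hm <;> simp [hm]
  · change ∀ s', s' = { s₁ with nat := Function.update s₁.nat 0 (choice k bins v) } → _
    rintro _ rfl
    have hrep : Represents k S bins { s₁ with nat := Function.update s₁.nat 0 (choice k bins v) } :=
      ⟨by simpa using hlen, fun i hi => by
        simpa only [Function.update_of_ne (show S + i ≠ 0 by omega)] using h₁.bin i hi⟩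
    refine Tot.ite (fun hb => ?_) fun hb => ?_
    · have hc : choice k bins v < bins.length := by
        simp [foundTest, hlen] at hb
        omega
      have hb := hrep.bin _ hc
      have hm : (typeBoxes k (s₁.nat (S + choice k bins v))).erase (boxOf k v) ∈ patterns k :=
        mem_patterns_of_le hk (typeBoxes_mem (h₁.bin _ hc).1) (Multiset.erase_le _ _)
      refine Tot.mono (Tot.seq_self (Tot.setN (Tot.setR ⟨?_, ?_, rfl⟩))) (by omega) fun _ h => h
      · rw [serve, if_pos hc]
        refine hrep.modify hc ?_ (fun j hj => ?_) (fun j hj => ?_) ?_ ?_ ?_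
        · simp [show 1 ≠ S + choice k bins v by omega]
        · simp [hj]
        · simp [show 0 ≠ S + choice k bins v by omega, hj]
        · rw [htab _ _ hc]
          simpa using typeOf_lt hm
        · rw [htab _ _ hc, addTo, if_neg hs, ← (h₁.bin _ hc).2.1]
          simpa using typeBoxes_typeOf hm
        · rw [addTo, if_neg hs, ← hb.2.2, hl, l1_of_nonneg (scaled_nonneg k _)]
          simp [binLoad, requestNorm, Function.update_apply,
            show 0 ≠ S + choice k bins v by omega, hR2, hR3, scaled, boxOf]
      · simp [show 0 ≠ S + choice k bins v by omega]
    · have hc : ¬ choice k bins v < bins.length := by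
        simp [foundTest, hlen] at hb
        omega
      exact tot_openBin hk hS hv.1 hrep hR (by simp) hc

theorem tot_serveProg (hk : 0 < k) (hS : 8 ≤ S) {bins : List Bin} {s : Config} {v : Vec}
    (hv : v ∈ Set.Icc (0 : ℝ × ℝ) 1) (h : Represents k S bins s) :
    Tot tape (serveProg k S) (s.input v) (6 * k + 2 * bins.length + 11) fun s' =>
      Represents k S (serve k bins v) s' ∧ s'.nat 0 = choice k bins v ∧ s'.head = s.head := by
  have h' : Represents k S bins (s.input v) := ⟨h.length, fun i hi => by
    have := h.bin i hi
    simpa [Config.input, Function.update_apply, show 4 + i ≠ 0 by omega,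
      show 4 + i ≠ 1 by omega] using this⟩
  have hr : ((s.input v).real 0, (s.input v).real 1) = v := by simp [Config.input]
  have hiff : (Test.and (.leR (.at 0) (.const (40 / k))) (.leR (.at 1) (.const (40 / k)))).Holds
      (s.input v) ↔ IsShort k v := by
    simp [Config.input, IsShort]
  refine Tot.mono (Tot.ite (T := 6 * k + 2 * bins.length + 10) (fun hb => ?_) fun hb => ?_)
    (by omega) fun _ h => h
  · rw [hiff] at hb
    exact Tot.mono (tot_serveShort hk hS hv.1 hb h' hr) (by omega) fun _ h => h
  · rw [hiff] at hb
    exact Tot.mono (tot_serveLong hk hS hv hb h' hr) (by omega) fun _ h => h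

end memory

/-! ### The complete program -/

/-- The first address of the bin types. -/
abbrev binAddr (k : ℕ) : ℕ := 8 + 2 * numTypes k + k * k

/-- The program for the strategy. -/
def strategyProg (k : ℕ) : OnlineProg where
  setup := .seq (readAdvice k (8 + 2 * numTypes k))
    (.seq (search (coef k) (numTypes k) (k * k) (List.range (numTypes k)))
      (openBins k (binAddr k) (numTypes k) (numTypes k)))
  step := serveProg k (binAddr k)

theorem length_pack_le {k : ℕ} (hk : 0 < k) {σ : List Vec}
    (hσ : ∀ v ∈ σ, v ∈ Set.Icc (0 : ℝ × ℝ) 1) :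
    (pack k (longBoxes k σ)).length ≤ σ.length := by
  have hN := longBoxes_subset hk hσ
  rw [(isOptimalBoxPacking_pack hk hN).2.2]
  refine (opt_le_card (norm_le_one_of_mem_map_scaled hk hN)).trans ?_
  rw [Multiset.card_map]
  exact card_longBoxes_le k σ

theorem tot_setup {tape : ℕ → Bool} {k : ℕ} (hk : 0 < k) {σ : List Vec}
    (hσ : ∀ v ∈ σ, v ∈ Set.Icc (0 : ℝ × ℝ) 1) (ht : StartsWith tape (advice k σ)) :
    Tot tape (strategyProg k).setup ⟨fun _ => 0, fun _ => 0, 0⟩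
      ((7 * (k * k) + 3 + k * k * 7) * σ.length + (5 + k * k * 7) +
        (searchTime (numTypes k) σ.length (List.range (numTypes k)) +
          (1 + numTypes k + 5 * σ.length))) fun s =>
      Represents k (binAddr k) (criticalBins k (pack k (longBoxes k σ))) s ∧
      s.head = (advice k σ).length := by
  have hN := longBoxes_subset hk hσ
  refine Tot.seq (tot_readAdvice hk (by omega) ht) ?_
  rintro s ⟨h1, h2, -, h4⟩
  refine Tot.seq (tot_search (N := boxCount k (longBoxes k σ))
    (by rw [card_eq_sum_boxCount hN]; exact card_longBoxes_le k σ) (List.range (numTypes k))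
    (fun p hp => List.mem_range.1 hp) List.nodup_range (fun _ => 0) (fun _ => 0) s
    ⟨fun p hp hp' => absurd (List.mem_range.2 hp) hp', fun p hp => ?_, fun q hq => ?_⟩) ?_
  · exact h4 _ (by unfold bAddr; omega) (by unfold bAddr; omega)
  · rw [← length_allBoxes] at hq
    refine (h1 q hq).trans ?_
    rw [boxCount, nthBox, List.getD_eq_getElem _ _ hq]
  · rintro s' ⟨⟨-, k2, -⟩, k4⟩
    refine Tot.mono (tot_openBins (k := k) (S := binAddr k) (T := numTypes k)
      (b := packCounts k (longBoxes k σ)) (by unfold binAddr; omega) le_rfl ?_ k2 _ le_rfl) ?_ ?_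
    · rw [k4.nat 1 (by omega), h4 1 (by omega) (by omega)]
    · have := length_pack_le hk hσ
      rw [pack, length_packingOf] at this
      omega
    · rintro s'' ⟨l1, l2, -⟩
      exact ⟨l1, by rw [l2, k4.head, h2]⟩

theorem length_serve_le (k : ℕ) (bins : List Bin) (v : Vec) :
    (serve k bins v).length ≤ bins.length + 1 := by
  unfold serve
  split_ifs <;> simp

/-- A request opens at most one bin, so the number of open bins plus the number of outstanding
requests never grows. Hence `L` bounds the length of every scan. -/
theorem exists_serves {tape : ℕ → Bool} {k S L : ℕ} (hk : 0 < k) (hS : 8 ≤ S) :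
    ∀ {σ : List Vec} {bins : List Bin} {s : Config}, (∀ v ∈ σ, v ∈ Set.Icc (0 : ℝ × ℝ) 1) →
    Represents k S bins s → bins.length + σ.length ≤ L →
    ∃ t s', t ≤ σ.length * (6 * k + 2 * L + 11) ∧
      Serves tape (serveProg k S) s σ (choices k bins σ) t s' ∧ s'.head = s.head
  | [], _, s, _, _, _ => ⟨0, s, Nat.zero_le _, .nil s, rfl⟩
  | v :: σ, bins, s, hσ, h, hL => by
    obtain ⟨t, s', ht, he, h1, h2, h3⟩ := tot_serveProg (tape := tape) hk hS (hσ v (by simp)) h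
    have hlen := length_serve_le k bins v
    rw [List.length_cons] at hL
    obtain ⟨t', s'', ht', hs, h4⟩ := exists_serves (L := L) hk hS
      (fun w hw => hσ w (List.mem_cons_of_mem _ hw)) h1 (by omega)
    refine ⟨t + t', s'', ?_, ?_, h4.trans h3⟩
    · rw [List.length_cons, Nat.succ_mul]
      omega
    · rw [choices, ← h2]
      exact .cons he hs

theorem exists_program {k : ℕ} (hk : 0 < k) :
    ∃ (pack : Multiset Box → List (Multiset Box)) (M : OnlineProg) (p : Polynomial ℕ),
      ∀ σ : List Vec, (∀ v ∈ σ, v ∈ Set.Icc (0 : ℝ × ℝ) 1) →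
        IsOptimalBoxPacking k (pack (longBoxes k σ)) (longBoxes k σ) ∧
        ∀ tape : ℕ → Bool, StartsWith tape (advice k σ) → ∃ t : ℕ, t ≤ p.eval σ.length ∧
          M.Runs tape σ (choices k (criticalBins k (pack (longBoxes k σ))) σ) t
            (advice k σ).length := by
  obtain ⟨P, hP⟩ := exists_polynomial_searchTime (numTypes k) (List.range (numTypes k))
  refine ⟨pack k, strategyProg k,
    (Polynomial.C (7 * (k * k) + 3 + k * k * 7) * Polynomial.X + Polynomial.C (5 + k * k * 7) +
      (P + (Polynomial.C (1 + numTypes k) + Polynomial.C 5 * Polynomial.X))) +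
    Polynomial.X * (Polynomial.C (6 * k) + Polynomial.C 4 * Polynomial.X + Polynomial.C 11),
    fun σ hσ => ⟨isOptimalBoxPacking_pack hk (longBoxes_subset hk hσ), fun tape ht => ?_⟩⟩
  obtain ⟨t₁, s, ht₁, he, hrep, hhead⟩ := tot_setup hk hσ ht
  have hlen : (criticalBins k (pack k (longBoxes k σ))).length ≤ σ.length := by
    rw [criticalBins, List.length_map]
    exact length_pack_le hk hσ
  -- At most n critical bins and at most n new ones are ever open.
  obtain ⟨t₂, s', ht₂, hs, hhead'⟩ := exists_serves (tape := tape) (L := 2 * σ.length) hk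
    (by unfold binAddr; omega) hσ hrep (by omega)
  refine ⟨t₁ + t₂, ?_, s, s', t₁, t₂, he, hs, rfl, by rw [hhead', hhead]⟩
  simp only [Polynomial.eval_add, Polynomial.eval_mul, Polynomial.eval_C, Polynomial.eval_X, ← hP]
  rw [← mul_assoc 2 2] at ht₂
  exact add_le_add ht₁ ht₂

end VectorPacking

end

theorem mainTheorem4 (k : ℕ) (hk : 640 ≤ k) (hk2 : Even k) :
    -- the number of bits of advice is `O(log n)`
    (∃ C : ℝ, ∀ σ : List VectorPacking.Vec, 2 ≤ σ.length →
      ((VectorPacking.advice k σ).length : ℝ) ≤ C * Real.log σ.length) ∧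
    -- some optimal packing rule makes the strategy, reading just this advice, polynomial-time
    (∃ (pack : Multiset VectorPacking.Box → List (Multiset VectorPacking.Box))
        (M : VectorPacking.OnlineProg) (p : Polynomial ℕ),
      ∀ σ : List VectorPacking.Vec, (∀ v ∈ σ, v ∈ Set.Icc (0 : ℝ × ℝ) 1) →
        VectorPacking.IsOptimalBoxPacking k (pack (VectorPacking.longBoxes k σ))
          (VectorPacking.longBoxes k σ) ∧
        ∀ tape : ℕ → Bool, VectorPacking.StartsWith tape (VectorPacking.advice k σ) →
          ∃ t : ℕ, t ≤ p.eval σ.length ∧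
            M.Runs tape σ
              (VectorPacking.choices k
                (VectorPacking.criticalBins k (pack (VectorPacking.longBoxes k σ))) σ)
              t (VectorPacking.advice k σ).length) ∧
    -- with every optimal packing rule, the result is a packing with at most `5/2 OPT + 1` bins
    (∀ σ : List VectorPacking.Vec, (∀ v ∈ σ, v ∈ Set.Icc (0 : ℝ × ℝ) 1) →
      ∀ P : List (Multiset VectorPacking.Box),
        VectorPacking.IsOptimalBoxPacking k P (VectorPacking.longBoxes k σ) →
        VectorPacking.IsPacking
          ((VectorPacking.finalBins k P σ).map VectorPacking.Bin.content) (σ : Multiset _) ∧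
        ((VectorPacking.finalBins k P σ).length : ℝ) ≤
          5 / 2 * (VectorPacking.opt (σ : Multiset _) : ℝ) + 1) := by
  have hk0 : 0 < k := by omega
  exact ⟨VectorPacking.length_advice_le k, VectorPacking.exists_program hk0, fun σ hσ P hP =>
    ⟨VectorPacking.isPacking_finalBins hk0 hσ hP, VectorPacking.length_finalBins_le hk hk2 hσ hP⟩⟩
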